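/- Let $G$ be a finite abelian group, written additively. A family $B_1,\dots,B_\ell$ of (not necessarily distinct) subsets of $G$ with $|B_i|=k_i$ is a \emph{difference family} with index $\lambda$ in $G$ if the list of differences $x-y$, with $x,y\in B_i$, $x\neq y$, $i=1,\dots,\ell$, represents every element of $G\setminus\{0\}$ exactly $\lambda$ times. A difference family with four blocks is of \emph{type $H_4^\ast$} if $\sum_{i=1}^4 k_i-(|G|+1)=\lambda$. Let $$\Phi_1=\{q^2 : q \text{ is a prime power},\ q\equiv 1 \pmod 4\},\qquad \Phi_2=\{n^4 : n\in\mathbb N \text{ odd}\}\cup\{9n^4 : n\in\mathbb N\text{ odd}\},$$ $$\Phi_3=\{5\},\qquad \Phi_4=\{13,37\}.$$ Then for every $v\in\Phi_1\cup\Phi_2\cup\Phi_3\cup\Phi_4$ there exists an abelian group of order $2v$ that contains a difference family of type $H_4^\ast$. -/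

import Mathlib

/-- A family `B` of subsets (blocks) of a finite abelian group `G` is a difference family with
index `lam` if the list of differences `x - y`, with `x ≠ y` in a common block `B i` and `i`
running over the index set, contains every nonzero element of `G` exactly `lam` times.
Blocks are indexed, so the same subset may occur several times. -/
def IsDifferenceFamily {G : Type*} [AddCommGroup G] [Fintype G] [DecidableEq G]
    {l : ℕ} (B : Fin l → Finset G) (lam : ℕ) : Prop :=
  ∀ g : G, g ≠ 0 →
    (Finset.univ.filter fun t : Fin l × G × G =>
      t.2.1 ∈ B t.1 ∧ t.2.2 ∈ B t.1 ∧ t.2.1 ≠ t.2.2 ∧ t.2.1 - t.2.2 = g).card = lam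

/-- A difference family with `l` blocks (used for `l = 2, 4, 8`) is of type `H_l^*` if its block
sizes `k_i` and its index `lam` satisfy `∑ k_i - l (|G| + 1) / 4 = lam`. -/
def IsTypeHStar {G : Type*} [AddCommGroup G] [Fintype G] [DecidableEq G]
    {l : ℕ} (B : Fin l → Finset G) : Prop :=
  ∃ lam : ℕ, IsDifferenceFamily B lam ∧
    (∑ i, ((B i).card : ℚ)) - (l : ℚ) * ((Fintype.card G : ℚ) + 1) / 4 = (lam : ℚ)

/-- Squares of prime powers congruent to `1` modulo `4`. -/
def Phi1 : Set ℕ := {v | ∃ q : ℕ, IsPrimePow q ∧ q ≡ 1 [MOD 4] ∧ v = q ^ 2}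

/-- The numbers `n ^ 4` and `9 n ^ 4` for odd `n`. -/
def Phi2 : Set ℕ := {v | ∃ n : ℕ, n ≡ 1 [MOD 2] ∧ v = n ^ 4} ∪
  {v | ∃ n : ℕ, n ≡ 1 [MOD 2] ∧ v = 9 * n ^ 4}

def Phi3 : Set ℕ := {5}

def Phi4 : Set ℕ := {13, 37}

/-!
A family of four blocks in a group `G` is of type `H_4^*` exactly when the `±1`-valued functions
that are `-1` on the blocks have autocorrelations adding up to `-4` at every nonzero element
(`HStar.exists_isTypeHStar_of_correlation`).  For even functions the autocorrelations are the
coefficients of squares in the integral group ring, so the required identity is one between sums of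
squares there.

For `G = ZMod 2 × H` with `|H| = v`, the squares are computed from five functions on `H` with
values in `{0, 1, -1}`, called a seed (`HStar.IsSeed`).  Writing `J` for the sum of the group
elements and `δ` for the unit, a seed satisfies `w₁² + w₂² = v + J`, `r₁² + r₂² = v - J` and
`e² = v - J`, and the blocks have the signs `(e + δ, e - δ)`, `(e + δ, δ - e)`,
`(w₁ - r₁, -w₁ - r₁)` and `(w₂ - r₂, -w₂ - r₂)` on the two cosets of `H`
(`HStar.IsSeed.exists_isTypeHStar`).  It remains to find seeds.

* `v = q²` with `q ≡ 1 [MOD 4]` (`HStar.exists_isSeed_plane`).  In the field `K` of order `q²` take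
  for `r₁` and `r₂` the real and imaginary parts of a quartic character with values in the Gaussian
  integers, and for `e` the quadratic character.  Elements of the subfield `F` of order `q` are
  squares in `K`, so on each line through the origin the quartic character is either real or
  imaginary; either case occurs on `(q + 1) / 2` lines.  As this number is odd, one can choose signs
  with sum `1` on each of the two sets of lines, and the signed sums of the indicator functions of
  the lines serve as `w₁` and `w₂`.

* `v = n⁴` and `v = 9 n⁴` with `n` odd.  Here the seeds are pure (`HStar.IsPureSeed`): moreover
  `w₁² = r₁² + J`, `w₂² = r₂² + J`, `w₁ w₂ = J` and `w₁ r₂ = w₂ r₁ = r₁ r₂ = 0`, while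
  `e = r₁ + r₂`.  Pure seeds are closed under products of groups (`HStar.IsPureSeed.prod`), so the
  orders `9` and `p⁴`, for odd primes `p`, suffice.  For order `p⁴` one works in the plane over the
  field `K` of order `p²` (`HStar.exists_isPureSeed_plane`).  The symmetric matrix
  `C β γ = η (det (dir β) (dir γ))`, indexed by the points of the projective line over `K` and built
  from the quadratic character `η` of `K`, has sign vectors as eigenvectors for both of the
  eigenvalues `p` and `-p`.  Half their sum and half their difference are functions `ε`, `ε'` with
  complementary supports which `C` interchanges up to the factor `p`.  The functions
  `x • dir β ↦ ε β * η x` and `x • dir β ↦ ε' β * η x` are `r₁` and `r₂`; again `w₁` and `w₂` are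
  signed sums of indicator functions of the lines in the two supports.

* `v = 5, 13, 37`: explicit blocks.
-/

namespace HStar

open Finset

/-! ### Differences and correlations -/

section Correlation

variable {G : Type*} [AddCommGroup G] [Fintype G] [DecidableEq G]

/-- The pairs with difference `g` are determined by their second entry. -/
lemma card_differences {l : ℕ} (B : Fin l → Finset G) {g : G} (hg : g ≠ 0) :
    (univ.filter fun t : Fin l × G × G =>
      t.2.1 ∈ B t.1 ∧ t.2.2 ∈ B t.1 ∧ t.2.1 ≠ t.2.2 ∧ t.2.1 - t.2.2 = g).card =
      ∑ i, (univ.filter fun y : G => y ∈ B i ∧ y + g ∈ B i).card := by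
  rw [card_filter, Fintype.sum_prod_type]
  refine sum_congr rfl fun i _ => ?_
  rw [card_filter, Fintype.sum_prod_type_right]
  refine sum_congr rfl fun y _ => ?_
  rw [sum_eq_single (y + g)]
  · have : y + g ≠ y := by simpa using hg
    simp [this, and_comm]
  · intro x _ hx
    rw [if_neg]
    rintro ⟨-, -, -, h⟩
    exact hx (by rw [← h]; abel)
  · simp

/-- Four `±1`-valued functions whose autocorrelations add up to `-4` away from `0` are the sign
functions of the blocks of a difference family of type `H_4^*`. -/
lemma exists_isTypeHStar_of_correlation [Nontrivial G] (a : Fin 4 → G → ℤ)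
    (ha : ∀ i x, a i x ^ 2 = 1)
    (hc : ∀ g : G, g ≠ 0 → ∑ i, ∑ x, a i x * a i (x + g) = -4) :
    ∃ B : Fin 4 → Finset G, IsTypeHStar B := by
  classical
  set B : Fin 4 → Finset G := fun i => univ.filter fun x => a i x = -1 with hB
  have hind (i : Fin 4) (x : G) : (2 * if x ∈ B i then 1 else 0 : ℤ) = 1 - a i x := by
    rcases mul_self_eq_one_iff.mp ((sq (a i x)).symm.trans (ha i x)) with h | h <;> simp [hB, h]
  have hcard (i : Fin 4) : 2 * ((B i).card : ℤ) = Fintype.card G - ∑ x, a i x := by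
    have : ((B i).card : ℤ) = ∑ x, if x ∈ B i then 1 else 0 := by simp
    rw [this, mul_sum, sum_congr rfl fun x _ => hind i x]
    simp
  have hN (g : G) (hg : g ≠ 0) :
      ((∑ i, (univ.filter fun y : G => y ∈ B i ∧ y + g ∈ B i).card : ℕ) : ℤ) =
        ∑ i, ((B i).card : ℤ) - Fintype.card G - 1 := by
    have h4 (i : Fin 4) : 4 * ((univ.filter fun y : G => y ∈ B i ∧ y + g ∈ B i).card : ℤ) =
        4 * (B i).card - Fintype.card G + ∑ x, a i x * a i (x + g) := by
      have h1 : ((univ.filter fun y : G => y ∈ B i ∧ y + g ∈ B i).card : ℤ) =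
          ∑ y, (if y ∈ B i then 1 else 0) * (if y + g ∈ B i then 1 else 0) := by
        rw [card_filter]; push_cast
        exact sum_congr rfl fun y _ => by split_ifs <;> simp_all
      have h2 : 4 * ((univ.filter fun y : G => y ∈ B i ∧ y + g ∈ B i).card : ℤ) =
          ∑ y, (1 - a i y) * (1 - a i (y + g)) := by
        rw [h1, mul_sum]
        exact sum_congr rfl fun y _ => by rw [← hind i y, ← hind i (y + g)]; ring
      have h3 : ∑ y, a i (y + g) = ∑ y, a i y := Equiv.sum_comp (Equiv.addRight g) (a i)
      have h5 : ∑ y, (1 - a i y) * (1 - a i (y + g)) =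
          Fintype.card G - ∑ y, a i y - ∑ y, a i (y + g) + ∑ y, a i y * a i (y + g) := by
        simp only [sub_mul, mul_sub, one_mul, mul_one, sum_sub_distrib]
        simp; ring
      rw [h2, h5, h3]; linarith [hcard i]
    have := sum_congr rfl fun (i : Fin 4) (_ : i ∈ univ) => h4 i
    rw [sum_add_distrib, hc g hg, sum_sub_distrib, ← mul_sum, ← mul_sum] at this
    push_cast
    simp only [sum_const, card_univ, Fintype.card_fin, nsmul_eq_mul] at this
    push_cast at this
    linarith
  obtain ⟨g₀, hg₀⟩ := exists_ne (0 : G)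
  refine ⟨B, ∑ i, (univ.filter fun y : G => y ∈ B i ∧ y + g₀ ∈ B i).card, ?_, ?_⟩
  · intro g hg
    rw [card_differences B hg]
    exact_mod_cast (hN g hg).trans (hN g₀ hg₀).symm
  · have := congrArg (Int.cast : ℤ → ℚ) (hN g₀ hg₀)
    push_cast at this ⊢
    rw [this]; ring

end Correlation

/-! ### Integral group rings -/

section GroupRing

variable {H : Type*} [Fintype H]

/-- The element `∑ x, f x • [x]` of the integral group ring of `H`, so that products become
convolutions. -/
noncomputable def alg (f : H → ℤ) : AddMonoidAlgebra ℤ H :=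
  ∑ x, AddMonoidAlgebra.single x (f x)

lemma coeff_alg (f : H → ℤ) (x : H) : (alg f).coeff x = f x := by
  classical
  simp [alg, AddMonoidAlgebra.coeff_sum, Finsupp.single_apply]

lemma alg_add (f g : H → ℤ) : alg (f + g) = alg f + alg g := by
  simp [alg, sum_add_distrib]

lemma alg_sub (f g : H → ℤ) : alg (f - g) = alg f - alg g := by
  simp [alg, AddMonoidAlgebra.single_sub, sum_sub_distrib]

lemma alg_neg (f : H → ℤ) : alg (-f) = -alg f := by
  simp [alg, AddMonoidAlgebra.single_neg]

variable [AddCommGroup H]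

lemma alg_single [DecidableEq H] : alg (Pi.single (0 : H) (1 : ℤ)) = 1 := by
  rw [alg, sum_eq_single 0]
  · simp [AddMonoidAlgebra.one_def]
  · intro b _ hb; simp [hb]
  · simp

lemma coeff_alg_mul (f g : H → ℤ) (u : H) :
    (alg f * alg g).coeff u = ∑ x, f x * g (u - x) := by
  classical
  simp only [alg, sum_mul_sum, AddMonoidAlgebra.single_mul_single, AddMonoidAlgebra.coeff_sum,
    Finsupp.finsetSum_apply, AddMonoidAlgebra.coeff_single]
  refine sum_congr rfl fun x _ => ?_
  rw [sum_eq_single (u - x)]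
  · simp
  · intro y _ hy
    rw [Finsupp.single_apply, if_neg]
    rintro h
    exact hy (by rw [← h]; abel)
  · simp

end GroupRing

/-! ### Seeds -/

section Seed

/-- The part of a Williamson-type family on an abelian group `H` that is needed to build a
difference family of type `H_4^*` in `ZMod 2 × H`: five even functions with values in
`{0, 1, -1}` such that `w₁`, `r₁` (and `w₂`, `r₂`) have complementary supports, `e` vanishes only
at `0`, and the convolution squares satisfy the stated identities, in which `alg 1` is the sum of
all group elements. -/
structure IsSeed {H : Type*} [AddCommGroup H] [Fintype H] (w₁ w₂ r₁ r₂ e : H → ℤ) : Prop where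
  even_w₁ : ∀ x, w₁ (-x) = w₁ x
  even_w₂ : ∀ x, w₂ (-x) = w₂ x
  even_r₁ : ∀ x, r₁ (-x) = r₁ x
  even_r₂ : ∀ x, r₂ (-x) = r₂ x
  even_e : ∀ x, e (-x) = e x
  supp₁ : ∀ x, w₁ x ^ 2 + r₁ x ^ 2 = 1
  supp₂ : ∀ x, w₂ x ^ 2 + r₂ x ^ 2 = 1
  e_zero : e 0 = 0
  e_sq : ∀ x, x ≠ 0 → e x ^ 2 = 1
  sq_w : alg w₁ ^ 2 + alg w₂ ^ 2 = (Fintype.card H : AddMonoidAlgebra ℤ H) + alg 1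
  sq_r : alg r₁ ^ 2 + alg r₂ ^ 2 = (Fintype.card H : AddMonoidAlgebra ℤ H) - alg 1
  sq_e : alg e ^ 2 = (Fintype.card H : AddMonoidAlgebra ℤ H) - alg 1

/-- The function on `ZMod 2 × H` given by `x` on `0 × H` and by `y` on `1 × H`. -/
def glue {H : Type*} (x y : H → ℤ) : ZMod 2 × H → ℤ := fun p => if p.1 = 0 then x p.2 else y p.2

lemma glue_sq {H : Type*} {x y : H → ℤ} (hx : ∀ t, x t ^ 2 = 1) (hy : ∀ t, y t ^ 2 = 1)
    (p : ZMod 2 × H) : glue x y p ^ 2 = 1 := by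
  unfold glue; split_ifs <;> simp only [hx, hy]

lemma glue_neg {H : Type*} [AddCommGroup H] {x y : H → ℤ} (hx : ∀ t, x (-t) = x t)
    (hy : ∀ t, y (-t) = y t) (p : ZMod 2 × H) : glue x y (-p) = glue x y p := by
  unfold glue; simp [hx, hy]

lemma single_one_sq {H : Type*} [AddCommGroup H] :
    (AddMonoidAlgebra.single ((1, 0) : ZMod 2 × H) (1 : ℤ)) ^ 2 = 1 := by
  have h : (1 : ZMod 2) + 1 = 0 := by decide
  rw [sq, AddMonoidAlgebra.single_mul_single, AddMonoidAlgebra.one_def]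
  simp [h, Prod.zero_eq_mk]

variable {H : Type*} [AddCommGroup H] [Fintype H]

lemma alg_glue (x y : H → ℤ) :
    alg (glue x y) =
      AddMonoidAlgebra.mapDomainRingHom ℤ (AddMonoidHom.inr (ZMod 2) H) (alg x) +
      AddMonoidAlgebra.single (1, 0) 1 *
        AddMonoidAlgebra.mapDomainRingHom ℤ (AddMonoidHom.inr (ZMod 2) H) (alg y) := by
  have h2 (f : ZMod 2 → AddMonoidAlgebra ℤ (ZMod 2 × H)) : ∑ i, f i = f 0 + f 1 :=
    Fin.sum_univ_two f
  simp only [alg, map_sum, mul_sum, Fintype.sum_prod_type, h2]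
  simp [glue, AddMonoidAlgebra.single_mul_single]

lemma correlation_eq_coeff_sq {f : H → ℤ} (hf : ∀ x, f (-x) = f x) (g : H) :
    ∑ x, f x * f (x + g) = (alg f ^ 2).coeff g := by
  rw [sq, coeff_alg_mul, ← Equiv.sum_comp (Equiv.neg H)]
  refine sum_congr rfl fun x _ => ?_
  rw [Equiv.neg_apply, hf, show g - x = -x + g by abel]

/-- A seed on `H` yields a difference family of type `H_4^*` in `ZMod 2 × H`. -/
theorem IsSeed.exists_isTypeHStar [DecidableEq H] {w₁ w₂ r₁ r₂ e : H → ℤ}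
    (h : IsSeed w₁ w₂ r₁ r₂ e) : ∃ B : Fin 4 → Finset (ZMod 2 × H), IsTypeHStar B := by
  set d : H → ℤ := Pi.single 0 1 with hd
  have hd_even (x : H) : d (-x) = d x := by simp [hd, Pi.single_apply]
  have hed (x : H) : (e x + d x) ^ 2 = 1 ∧ (e x - d x) ^ 2 = 1 := by
    by_cases hx : x = 0
    · subst hx; rw [h.e_zero]; simp [hd]
    · have : d x = 0 := by simp [hd, hx]
      rw [this, add_zero, sub_zero]; exact ⟨h.e_sq x hx, h.e_sq x hx⟩
  have hsupp {w r : ℤ} (hwr : w ^ 2 + r ^ 2 = 1) : (w - r) ^ 2 = 1 ∧ (-(w + r)) ^ 2 = 1 := by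
    have hwr0 : w * r = 0 := by
      by_contra hne
      have h1 := sq_pos_of_ne_zero (left_ne_zero_of_mul hne)
      have h2 := sq_pos_of_ne_zero (right_ne_zero_of_mul hne)
      omega
    exact ⟨by linear_combination hwr - 2 * hwr0, by linear_combination hwr + 2 * hwr0⟩
  -- The functions on the two cosets of `H`, for each of the four blocks.
  set X : Fin 4 → H → ℤ := ![e + d, e + d, w₁ - r₁, w₂ - r₂] with hX
  set Y : Fin 4 → H → ℤ := ![e - d, d - e, -(w₁ + r₁), -(w₂ + r₂)] with hY
  have hXsq (i : Fin 4) (t : H) : X i t ^ 2 = 1 := by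
    fin_cases i
    · exact (hed t).1
    · exact (hed t).1
    · exact (hsupp (h.supp₁ t)).1
    · exact (hsupp (h.supp₂ t)).1
  have hYsq (i : Fin 4) (t : H) : Y i t ^ 2 = 1 := by
    fin_cases i
    · exact (hed t).2
    · exact (sub_sq_comm _ _).trans (hed t).2
    · exact (hsupp (h.supp₁ t)).2
    · exact (hsupp (h.supp₂ t)).2
  have hXev (i : Fin 4) (t : H) : X i (-t) = X i t := by
    fin_cases i <;> simp [hX, h.even_e, hd_even, h.even_w₁, h.even_w₂, h.even_r₁, h.even_r₂]
  have hYev (i : Fin 4) (t : H) : Y i (-t) = Y i t := by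
    fin_cases i <;> simp [hY, h.even_e, hd_even, h.even_w₁, h.even_w₂, h.even_r₁, h.even_r₂]
  refine exists_isTypeHStar_of_correlation (fun i => glue (X i) (Y i))
    (fun i => glue_sq (hXsq i) (hYsq i)) fun g hg => ?_
  have hsum : ∑ i, alg (glue (X i) (Y i)) ^ 2 =
      8 * (Fintype.card H : AddMonoidAlgebra ℤ (ZMod 2 × H)) + 4 - 4 * alg 1 := by
    have h1 : (1 : ZMod 2 × H → ℤ) = glue 1 1 := by ext; simp [glue]
    have hw := congrArg
      (AddMonoidAlgebra.mapDomainRingHom ℤ (AddMonoidHom.inr (ZMod 2) H)) h.sq_w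
    have hr := congrArg
      (AddMonoidAlgebra.mapDomainRingHom ℤ (AddMonoidHom.inr (ZMod 2) H)) h.sq_r
    have he := congrArg
      (AddMonoidAlgebra.mapDomainRingHom ℤ (AddMonoidHom.inr (ZMod 2) H)) h.sq_e
    have hz := single_one_sq (H := H)
    rw [h1]
    simp only [Fin.sum_univ_four, alg_glue]
    simp only [hX, hY, Matrix.cons_val_zero, Matrix.cons_val_one, Matrix.cons_val,
      alg_add, alg_sub, alg_neg, hd, alg_single, map_add, map_sub, map_neg, map_pow, map_one,
      map_natCast] at hw hr he ⊢
    generalize AddMonoidAlgebra.single ((1, 0) : ZMod 2 × H) (1 : ℤ) = z at *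
    generalize AddMonoidAlgebra.mapDomainRingHom ℤ (AddMonoidHom.inr (ZMod 2) H) = φ at *
    linear_combination 4 * he + 2 * (hw + hr) - 2 * z * (hw - hr) +
      (2 * (φ (alg e) - 1) ^ 2 + (φ (alg w₁) + φ (alg r₁)) ^ 2 +
        (φ (alg w₂) + φ (alg r₂)) ^ 2) * hz
  have := congrArg (fun a => a.coeff g) hsum
  simp only [AddMonoidAlgebra.coeff_sum, Finsupp.finsetSum_apply] at this
  rw [sum_congr rfl fun i _ => correlation_eq_coeff_sq (glue_neg (hXev i) (hYev i)) g, this]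
  have hc : (8 * (Fintype.card H : AddMonoidAlgebra ℤ (ZMod 2 × H)) + 4 - 4 * alg 1) =
      ((8 * Fintype.card H + 4 : ℕ) : AddMonoidAlgebra ℤ (ZMod 2 × H)) - (4 : ℤ) • alg 1 := by
    rw [zsmul_eq_mul]; push_cast; ring
  rw [hc, AddMonoidAlgebra.natCast_def]
  simp [coeff_alg, hg.symm, -zsmul_eq_mul]

end Seed

/-! ### Pure seeds and their products -/

section Pure

/-- A seed-like quadruple with the stronger property that the Fourier transforms of `w₁`, `r₁` have
the same support off the trivial character, as have those of `w₂`, `r₂`, and that these two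
supports are complementary.  Spelled out in the group ring, this is what makes the notion stable
under products of groups. -/
structure IsPureSeed {H : Type*} [AddCommGroup H] [Fintype H] (w₁ w₂ r₁ r₂ : H → ℤ) : Prop where
  even_w₁ : ∀ x, w₁ (-x) = w₁ x
  even_w₂ : ∀ x, w₂ (-x) = w₂ x
  even_r₁ : ∀ x, r₁ (-x) = r₁ x
  even_r₂ : ∀ x, r₂ (-x) = r₂ x
  supp₁ : ∀ x, w₁ x ^ 2 + r₁ x ^ 2 = 1
  supp₂ : ∀ x, w₂ x ^ 2 + r₂ x ^ 2 = 1
  r₁_zero : r₁ 0 = 0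
  r₂_zero : r₂ 0 = 0
  supp_r : ∀ x, x ≠ 0 → r₁ x ^ 2 + r₂ x ^ 2 = 1
  sq_w₁ : alg w₁ ^ 2 = alg r₁ ^ 2 + alg 1
  sq_w₂ : alg w₂ ^ 2 = alg r₂ ^ 2 + alg 1
  w₁_mul_w₂ : alg w₁ * alg w₂ = alg 1
  w₁_mul_r₂ : alg w₁ * alg r₂ = 0
  w₂_mul_r₁ : alg w₂ * alg r₁ = 0
  r₁_mul_r₂ : alg r₁ * alg r₂ = 0
  sq_r : alg r₁ ^ 2 + alg r₂ ^ 2 = (Fintype.card H : AddMonoidAlgebra ℤ H) - alg 1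

/-- Two integers whose squares add up to `1` are `0` and a sign, in some order. -/
lemma sq_add_sq_eq_one {a b : ℤ} (h : a ^ 2 + b ^ 2 = 1) :
    (a = 0 ∧ b ^ 2 = 1) ∨ (a ^ 2 = 1 ∧ b = 0) := by
  by_cases ha : a = 0
  · subst ha; left; simpa using h
  · have h1 := sq_pos_of_ne_zero ha
    have h2 : b ^ 2 = 0 := by have := sq_nonneg b; omega
    right; exact ⟨by omega, pow_eq_zero_iff two_ne_zero |>.mp h2⟩

theorem IsPureSeed.isSeed {H : Type*} [AddCommGroup H] [Fintype H] {w₁ w₂ r₁ r₂ : H → ℤ}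
    (h : IsPureSeed w₁ w₂ r₁ r₂) : IsSeed w₁ w₂ r₁ r₂ (r₁ + r₂) where
  even_w₁ := h.even_w₁
  even_w₂ := h.even_w₂
  even_r₁ := h.even_r₁
  even_r₂ := h.even_r₂
  even_e x := by simp [h.even_r₁, h.even_r₂]
  supp₁ := h.supp₁
  supp₂ := h.supp₂
  e_zero := by simp [h.r₁_zero, h.r₂_zero]
  e_sq x hx := by
    rcases sq_add_sq_eq_one (h.supp_r x hx) with ⟨h1, h2⟩ | ⟨h1, h2⟩ <;> simp only [Pi.add_apply]
    · rw [h1, zero_add, h2]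
    · rw [h2, add_zero, h1]
  sq_w := by linear_combination h.sq_w₁ + h.sq_w₂ + h.sq_r
  sq_r := h.sq_r
  sq_e := by rw [alg_add]; linear_combination h.sq_r + 2 * h.r₁_mul_r₂

/-- The tensor product of two functions, as a function on the product. -/
def tensor {H H' : Type*} (f : H → ℤ) (g : H' → ℤ) : H × H' → ℤ := fun p => f p.1 * g p.2

variable {H H' : Type*} [AddCommGroup H] [Fintype H] [AddCommGroup H'] [Fintype H']

lemma alg_tensor (f : H → ℤ) (g : H' → ℤ) :
    alg (tensor f g) =
      AddMonoidAlgebra.mapDomainRingHom ℤ (AddMonoidHom.inl H H') (alg f) *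
      AddMonoidAlgebra.mapDomainRingHom ℤ (AddMonoidHom.inr H H') (alg g) := by
  simp [alg, sum_mul_sum, Fintype.sum_prod_type, AddMonoidAlgebra.single_mul_single, tensor]

lemma IsPureSeed.cases {w₁ w₂ r₁ r₂ : H → ℤ} (h : IsPureSeed w₁ w₂ r₁ r₂) (x : H) :
    (x = 0 ∧ r₁ x = 0 ∧ r₂ x = 0 ∧ w₁ x ^ 2 = 1 ∧ w₂ x ^ 2 = 1) ∨
    (x ≠ 0 ∧ r₁ x = 0 ∧ w₂ x = 0 ∧ r₂ x ^ 2 = 1 ∧ w₁ x ^ 2 = 1) ∨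
    (x ≠ 0 ∧ r₂ x = 0 ∧ w₁ x = 0 ∧ r₁ x ^ 2 = 1 ∧ w₂ x ^ 2 = 1) := by
  by_cases hx : x = 0
  · left
    subst hx
    have h1 := h.supp₁ 0
    have h2 := h.supp₂ 0
    rw [h.r₁_zero] at h1
    rw [h.r₂_zero] at h2
    exact ⟨rfl, h.r₁_zero, h.r₂_zero, by simpa only [ne_eq, OfNat.ofNat_ne_zero,
      not_false_eq_true, zero_pow, add_zero] using h1, by simpa only [ne_eq, OfNat.ofNat_ne_zero,
      not_false_eq_true, zero_pow, add_zero] using h2⟩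
  · right
    have h1 := h.supp₁ x
    have h2 := h.supp₂ x
    rcases sq_add_sq_eq_one (h.supp_r x hx) with ⟨h3, h4⟩ | ⟨h3, h4⟩
    · rw [h3] at h1
      exact Or.inl ⟨hx, h3, pow_eq_zero_iff two_ne_zero |>.mp (by linarith), h4, by linarith⟩
    · rw [h4] at h2
      exact Or.inr ⟨hx, h4, pow_eq_zero_iff two_ne_zero |>.mp (by linarith), h3, by linarith⟩

/-- The product seed; its four functions have complementary supports because at each point exactly
one of the two summands is nonzero. -/
theorem IsPureSeed.prod {w₁ w₂ r₁ r₂ : H → ℤ} {w₁' w₂' r₁' r₂' : H' → ℤ}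
    (h : IsPureSeed w₁ w₂ r₁ r₂) (h' : IsPureSeed w₁' w₂' r₁' r₂') :
    IsPureSeed (tensor w₁ w₁' + tensor r₂ r₁') (tensor w₂ w₂' + tensor r₁ r₂')
      (tensor r₁ w₁' + tensor w₂ r₁') (tensor r₂ w₂' + tensor w₁ r₂') := by
  have h1 : (1 : H × H' → ℤ) = tensor 1 1 := by ext; simp [tensor]
  set φ := AddMonoidAlgebra.mapDomainRingHom ℤ (AddMonoidHom.inl H H') with hφ
  set ψ := AddMonoidAlgebra.mapDomainRingHom ℤ (AddMonoidHom.inr H H') with hψ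
  have a1 := congrArg φ h.sq_w₁
  have a2 := congrArg φ h.sq_w₂
  have a3 := congrArg φ h.w₁_mul_w₂
  have a4 := congrArg φ h.w₁_mul_r₂
  have a5 := congrArg φ h.w₂_mul_r₁
  have a6 := congrArg φ h.r₁_mul_r₂
  have a7 := congrArg φ h.sq_r
  have b1 := congrArg ψ h'.sq_w₁
  have b2 := congrArg ψ h'.sq_w₂
  have b3 := congrArg ψ h'.w₁_mul_w₂
  have b4 := congrArg ψ h'.w₁_mul_r₂
  have b5 := congrArg ψ h'.w₂_mul_r₁
  have b6 := congrArg ψ h'.r₁_mul_r₂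
  have b7 := congrArg ψ h'.sq_r
  simp only [map_add, map_sub, map_mul, map_pow, map_natCast, map_zero] at a1 a2 a3 a4 a5 a6 a7
  simp only [map_add, map_sub, map_mul, map_pow, map_natCast, map_zero] at b1 b2 b3 b4 b5 b6 b7
  constructor
  · intro x; simp [tensor, h.even_w₁, h'.even_w₁, h.even_r₂, h'.even_r₁]
  · intro x; simp [tensor, h.even_w₂, h'.even_w₂, h.even_r₁, h'.even_r₂]
  · intro x; simp [tensor, h.even_r₁, h'.even_w₁, h.even_w₂, h'.even_r₁]
  · intro x; simp [tensor, h.even_r₂, h'.even_w₂, h.even_w₁, h'.even_r₂]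
  · rintro ⟨x, y⟩
    rcases h.cases x with ⟨-, c1, c2, c3, c4⟩ | ⟨-, c1, c2, c3, c4⟩ | ⟨-, c1, c2, c3, c4⟩ <;>
    rcases h'.cases y with ⟨-, d1, d2, d3, d4⟩ | ⟨-, d1, d2, d3, d4⟩ | ⟨-, d1, d2, d3, d4⟩ <;>
    simp only [Pi.add_apply, tensor, c1, c2, c3, c4, d1, d2, d3, d4, mul_pow, mul_zero, zero_mul,
      add_zero, zero_add, mul_one, ne_eq, OfNat.ofNat_ne_zero, not_false_eq_true, zero_pow]
  · rintro ⟨x, y⟩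
    rcases h.cases x with ⟨-, c1, c2, c3, c4⟩ | ⟨-, c1, c2, c3, c4⟩ | ⟨-, c1, c2, c3, c4⟩ <;>
    rcases h'.cases y with ⟨-, d1, d2, d3, d4⟩ | ⟨-, d1, d2, d3, d4⟩ | ⟨-, d1, d2, d3, d4⟩ <;>
    simp only [Pi.add_apply, tensor, c1, c2, c3, c4, d1, d2, d3, d4, mul_pow, mul_zero, zero_mul,
      add_zero, zero_add, mul_one, ne_eq, OfNat.ofNat_ne_zero, not_false_eq_true, zero_pow]
  · simp [tensor, h.r₁_zero, h'.r₁_zero]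
  · simp [tensor, h.r₂_zero, h'.r₂_zero]
  · rintro ⟨x, y⟩ hxy
    rcases h.cases x with ⟨c0, c1, c2, c3, c4⟩ | ⟨c0, c1, c2, c3, c4⟩ | ⟨c0, c1, c2, c3, c4⟩ <;>
    rcases h'.cases y with ⟨d0, d1, d2, d3, d4⟩ | ⟨d0, d1, d2, d3, d4⟩ | ⟨d0, d1, d2, d3, d4⟩
    · exact absurd (Prod.ext c0 d0) hxy
    all_goals
      simp only [Pi.add_apply, tensor, c1, c2, c3, c4, d1, d2, d3, d4, mul_pow, mul_zero,
        zero_mul, add_zero, zero_add, mul_one, ne_eq, OfNat.ofNat_ne_zero, not_false_eq_true,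
        zero_pow]
  all_goals
    simp only [h1, alg_add, alg_tensor, ← hφ, ← hψ, Fintype.card_prod, Nat.cast_mul]
    clear_value φ ψ
    generalize φ (alg w₁) = W at *
    generalize φ (alg w₂) = X at *
    generalize φ (alg r₁) = R at *
    generalize φ (alg r₂) = S at *
    generalize φ (alg 1) = J at *
    generalize ψ (alg w₁') = W' at *
    generalize ψ (alg w₂') = X' at *
    generalize ψ (alg r₁') = R' at *
    generalize ψ (alg r₂') = S' at *
    generalize ψ (alg 1) = J' at *
  · linear_combination W' ^ 2 * a1 + 2 * W' * R' * a4 - 2 * W' * R' * a5 - R' ^ 2 * a2 + J * b1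
  · linear_combination X' ^ 2 * a2 + 2 * X' * S' * a5 - 2 * X' * S' * a4 - S' ^ 2 * a1 + J * b2
  · linear_combination W' * X' * a3 + J * b3 + W * R * b4 + S * X * b5 + R' * S' * a6
  · linear_combination (W' * X' + R' * S') * a4 + W ^ 2 * b4 + S ^ 2 * b5
  · linear_combination (X' * W' + S' * R') * a5 + X ^ 2 * b5 + R ^ 2 * b4
  · linear_combination W' * X' * a6 + R * W * b4 + X * S * b5 + X * W * b6
  · linear_combination R ^ 2 * b1 + 2 * W' * R' * a5 + R' ^ 2 * a2 + S ^ 2 * b2 +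
      2 * X' * S' * a4 + S' ^ 2 * a1 + (R' ^ 2 + S' ^ 2 + J') * a7 + Fintype.card H * b7

end Pure

/-! ### The trivial group and the group of order nine -/

section Small

theorem isPureSeed_trivial : IsPureSeed (H := Unit) 1 1 0 0 := by
  have h : alg (H := Unit) 1 = 1 := by
    simp [alg, AddMonoidAlgebra.one_def]
  have h0 : alg (H := Unit) 0 = 0 := by simp [alg]
  constructor <;> simp [h, h0]

lemma alg_ext_iff {H : Type*} [Fintype H] {a b : AddMonoidAlgebra ℤ H} :
    a = b ↔ ∀ x, a.coeff x = b.coeff x := by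
  rw [← DFunLike.ext_iff, AddMonoidAlgebra.coeff_inj]

/-- The indicator function of the line `a x + b y = 0` in `ZMod 3 × ZMod 3`. -/
def line3 (a b : ZMod 3) (x : ZMod 3 × ZMod 3) : ℤ := if a * x.1 + b * x.2 = 0 then 1 else 0

/-- The sum of the indicator functions of the two lines other than `a x + b y = 0` and
`c x + d y = 0`, minus the constant `1`. -/
def w3 (a b c d : ZMod 3) (x : ZMod 3 × ZMod 3) : ℤ :=
  (if x = 0 then 3 else 0) - line3 a b x - line3 c d x

/-- The difference of the indicator functions of `a x + b y = 0` and `c x + d y = 0`. -/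
def r3 (a b c d : ZMod 3) (x : ZMod 3 × ZMod 3) : ℤ := line3 a b x - line3 c d x

/-- A pure seed of order `9`, made of the indicator functions of the four lines through the
origin. -/
theorem isPureSeed_nine :
    IsPureSeed (w3 1 1 1 2) (w3 1 0 0 1) (r3 1 0 0 1) (r3 1 1 1 2) := by
  constructor
  case sq_w₁ | sq_w₂ | w₁_mul_w₂ =>
    rw [alg_ext_iff]
    simp only [sq, coeff_alg_mul, AddMonoidAlgebra.coeff_add, Finsupp.add_apply, coeff_alg]
    decide
  case w₁_mul_r₂ | w₂_mul_r₁ | r₁_mul_r₂ =>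
    rw [alg_ext_iff]
    simp only [coeff_alg_mul, AddMonoidAlgebra.coeff_zero, Finsupp.zero_apply]
    decide
  case sq_r =>
    rw [alg_ext_iff]
    simp only [sq, coeff_alg_mul, AddMonoidAlgebra.coeff_add, AddMonoidAlgebra.coeff_sub,
      Finsupp.add_apply, Finsupp.sub_apply, coeff_alg, AddMonoidAlgebra.coeff_natCast,
      Finsupp.single_apply]
    decide
  all_goals decide

end Small

/-! ### Multiplicative characters -/

section MulChar

variable {k : Type*} [Field k] [Fintype k]

/-- Off the identity, the correlations of a nontrivial even character are all `-1`; this is the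
Jacobi sum of a character and its inverse. -/
lemma sum_mulChar_mul_inv {R : Type*} [CommRing R] [IsDomain R] {χ : MulChar k R}
    (hχ : χ ≠ 1) (h1 : χ (-1) = 1) {u : k} (hu : u ≠ 0) :
    ∑ x, χ x * χ⁻¹ (u - x) = -1 := by
  have h := jacobiSum_nontrivial_inv hχ
  rw [h1] at h
  rw [← h, jacobiSum, ← Equiv.sum_comp (Equiv.mulLeft₀ u hu)]
  refine sum_congr rfl fun y _ => ?_
  have : u - u * y = u * (1 - y) := by ring
  rw [Equiv.mulLeft₀_apply, this, map_mul, map_mul, mul_mul_mul_comm, ← MulChar.mul_apply,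
    mul_inv_cancel, MulChar.one_apply hu.isUnit, one_mul]

lemma sum_mulChar_mul_inv_zero {R : Type*} [CommRing R] [IsDomain R] {χ : MulChar k R}
    (h1 : χ (-1) = 1) : ∑ x, χ x * χ⁻¹ (0 - x) = Fintype.card k - 1 := by
  classical
  have h (x : k) : χ x * χ⁻¹ (0 - x) = 1 - if x = 0 then 1 else 0 := by
    split_ifs with hx
    · rw [hx, MulChar.map_zero, zero_mul, sub_self]
    · have h1' : χ⁻¹ (-1) = 1 := by rw [MulChar.inv_apply', inv_neg, inv_one, h1]
      rw [zero_sub, ← neg_one_mul, map_mul, h1', one_mul, ← MulChar.mul_apply, mul_inv_cancel,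
        MulChar.one_apply (isUnit_iff_ne_zero.mpr hx), sub_zero]
  rw [sum_congr rfl fun x _ => h x]
  simp

variable [DecidableEq k]

lemma alg_quadraticChar_sq (hk : ringChar k ≠ 2) (h1 : quadraticChar k (-1) = 1) :
    alg (quadraticChar k) ^ 2 = (Fintype.card k : AddMonoidAlgebra ℤ k) - alg 1 := by
  have hinv : (quadraticChar k)⁻¹ = quadraticChar k := (quadraticChar_isQuadratic k).inv
  ext u
  rw [sq, coeff_alg_mul]
  simp only [AddMonoidAlgebra.coeff_sub, Finsupp.sub_apply, coeff_alg,
    AddMonoidAlgebra.coeff_natCast, Finsupp.single_apply, Pi.one_apply]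
  by_cases hu : u = 0
  · have := sum_mulChar_mul_inv_zero h1
    rw [hinv] at this
    subst hu
    rw [this]; simp
  · have := sum_mulChar_mul_inv (quadraticChar_ne_one hk) h1 hu
    rw [hinv] at this
    rw [this]; simp [Ne.symm hu]

lemma alg_one_mul {H : Type*} [AddCommGroup H] [Fintype H] (f : H → ℤ) :
    alg 1 * alg f = ((∑ x, f x : ℤ) : AddMonoidAlgebra ℤ H) * alg 1 := by
  ext u
  rw [coeff_alg_mul, ← zsmul_eq_mul, AddMonoidAlgebra.coeff_smul]
  simp only [Pi.one_apply, one_mul, Finsupp.smul_apply, coeff_alg, smul_eq_mul, mul_one]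
  exact Equiv.sum_comp (Equiv.subLeft u) f

lemma alg_one_mul_quadraticChar (hk : ringChar k ≠ 2) : alg 1 * alg (quadraticChar k) = 0 := by
  rw [alg_one_mul, quadraticChar_sum_zero hk]; simp

end MulChar

/-! ### Lines in a finite plane -/

section Plane

variable {k : Type*} [Field k]

/-- The vectors `(0, 1)` and `(1, b)`, which represent the points of the projective line. -/
def dir : Option k → k × k
  | none => (0, 1)
  | some b => (1, b)

/-- The determinant of two vectors; it vanishes if and only if they are proportional. -/
def det (u v : k × k) : k := u.1 * v.2 - u.2 * v.1

lemma det_swap (u v : k × k) : det u v = -det v u := by simp only [det]; ring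

lemma det_smul_right (c : k) (u v : k × k) : det u (c • v) = c * det u v := by
  simp only [det, Prod.smul_fst, Prod.smul_snd, smul_eq_mul]; ring

lemma det_dir_ne_zero {β γ : Option k} (h : β ≠ γ) : det (dir β) (dir γ) ≠ 0 := by
  rcases β with _ | b <;> rcases γ with _ | c
  · exact absurd rfl h
  · simp [det, dir]
  · simp [det, dir]
  · have : b ≠ c := fun e => h (by rw [e])
    simpa [det, dir, sub_eq_zero] using this.symm

lemma det_dir_self (β : Option k) : det (dir β) (dir β) = 0 := by simp only [det]; ring

lemma dir_ne_zero (β : Option k) : dir β ≠ 0 := by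
  rcases β with _ | b <;> simp [dir]

lemma det_dir_eq_zero {β : Option k} {u : k × k} (h : det (dir β) u = 0) :
    ∃ x : k, u = x • dir β := by
  rcases β with _ | b
  · exact ⟨u.2, by ext <;> simp_all [det, dir]⟩
  · exact ⟨u.1, by ext <;> simp_all [det, dir, sub_eq_zero, mul_comm]⟩

section

variable [Fintype k]

/-- The map of group rings induced by the inclusion of the line spanned by `dir β`. -/
noncomputable def lineHom (β : Option k) :
    AddMonoidAlgebra ℤ k →+* AddMonoidAlgebra ℤ (k × k) :=
  AddMonoidAlgebra.mapDomainRingHom ℤ (LinearMap.toSpanSingleton k (k × k) (dir β)).toAddMonoidHom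

lemma lineHom_alg (β : Option k) (f : k → ℤ) :
    lineHom β (alg f) = ∑ x, AddMonoidAlgebra.single (x • dir β) (f x) := by
  simp [lineHom, alg]

/-- Every vector is uniquely the sum of a vector on a line and one on a different line, with
coordinates given by Cramer's rule. -/
lemma lineHom_mul_lineHom {β γ : Option k} (h : β ≠ γ) (f g : k → ℤ) :
    lineHom β (alg f) * lineHom γ (alg g) = alg fun u =>
      f (det u (dir γ) / det (dir β) (dir γ)) * g (det (dir β) u / det (dir β) (dir γ)) := by
  have hd := det_dir_ne_zero h
  have h1 (x y : k) : det (x • dir β + y • dir γ) (dir γ) / det (dir β) (dir γ) = x := by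
    rw [div_eq_iff hd]
    simp only [det, Prod.fst_add, Prod.snd_add, Prod.smul_fst, Prod.smul_snd, smul_eq_mul]
    ring
  have h2 (x y : k) : det (dir β) (x • dir β + y • dir γ) / det (dir β) (dir γ) = y := by
    rw [div_eq_iff hd]
    simp only [det, Prod.fst_add, Prod.snd_add, Prod.smul_fst, Prod.smul_snd, smul_eq_mul]
    ring
  rw [lineHom_alg, lineHom_alg, sum_mul_sum, ← sum_product', alg]
  simp only [AddMonoidAlgebra.single_mul_single]
  refine sum_nbij' (fun p => p.1 • dir β + p.2 • dir γ)
    (fun u => (det u (dir γ) / det (dir β) (dir γ), det (dir β) u / det (dir β) (dir γ)))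
    (by simp) (by simp) ?_ ?_ ?_
  · rintro ⟨x, y⟩ _
    exact Prod.ext (h1 x y) (h2 x y)
  · intro u _
    ext <;> simp only [Prod.fst_add, Prod.snd_add, Prod.smul_fst, Prod.smul_snd, smul_eq_mul] <;>
      rw [div_mul_eq_mul_div, div_mul_eq_mul_div, ← add_div, div_eq_iff hd] <;>
      simp only [det] <;> ring
  · rintro ⟨x, y⟩ _
    simp only [h1, h2]

end

variable [DecidableEq k]

/-- The point of the projective line below a nonzero vector. -/
def slope (u : k × k) : Option k := if u.1 = 0 then none else some (u.2 / u.1)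

/-- The factor by which `dir (slope u)` has to be multiplied to give `u`. -/
def scal (u : k × k) : k := if u.1 = 0 then u.2 else u.1

lemma scal_smul_dir (u : k × k) : scal u • dir (slope u) = u := by
  unfold scal slope
  split_ifs with h
  · ext <;> simp [dir, h]
  · ext <;> simp [dir]
    field_simp

lemma slope_smul_dir {x : k} (hx : x ≠ 0) (β : Option k) : slope (x • dir β) = β := by
  rcases β with _ | b
  · simp [slope, dir]
  · simp [slope, dir, hx]

lemma scal_smul_dir' {x : k} (hx : x ≠ 0) (β : Option k) : scal (x • dir β) = x := by
  rcases β with _ | b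
  · simp [scal, dir]
  · simp [scal, dir, hx]

lemma scal_eq_zero {u : k × k} : scal u = 0 ↔ u = 0 := by
  constructor
  · intro h; rw [← scal_smul_dir u, h, zero_smul]
  · rintro rfl; simp [scal]

variable [Fintype k]

/-- Every nonzero vector lies on exactly one line through the origin. -/
lemma sum_lines {M : Type*} [AddCommMonoid M] (G : Option k → k → M) :
    ∑ β, ∑ x with x ≠ 0, G β x = ∑ u with u ≠ 0, G (slope u) (scal u) := by
  rw [← sum_product']
  refine sum_nbij' (fun p => p.2 • dir p.1) (fun u => (slope u, scal u)) ?_ ?_ ?_ ?_ ?_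
  · rintro ⟨β, x⟩ h
    simp only [mem_product, mem_univ, mem_filter, true_and] at h ⊢
    rw [ne_eq, ← scal_eq_zero, scal_smul_dir' h]; exact h
  · intro u h
    simp only [mem_product, mem_univ, mem_filter, true_and] at h ⊢
    rwa [ne_eq, scal_eq_zero]
  · rintro ⟨β, x⟩ h
    simp only [mem_product, mem_univ, mem_filter, true_and] at h
    simp [slope_smul_dir h, scal_smul_dir' h]
  · intro u _; exact scal_smul_dir u
  · rintro ⟨β, x⟩ h
    simp only [mem_product, mem_univ, mem_filter, true_and] at h
    simp [slope_smul_dir h, scal_smul_dir' h]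

lemma sum_eq_zero_add_sum_ne_zero {H M : Type*} [AddCommGroup H] [Fintype H] [DecidableEq H]
    [AddCommMonoid M] (f : H → M) : ∑ x, f x = f 0 + ∑ x with x ≠ 0, f x := by
  rw [← sum_filter_add_sum_filter_not univ (fun x : H => x = 0)]
  simp [filter_eq']

/-- The combination `∑ σ β • 1_L` of the indicator functions of the lines `L = k • dir β`. -/
def lineSum (σ : Option k → ℤ) (u : k × k) : ℤ := if u = 0 then ∑ β, σ β else σ (slope u)

/-- The function `x • dir β ↦ ε β * η x`, where `η` is the quadratic character. -/
def halfLineSum (ε : Option k → ℤ) (u : k × k) : ℤ := ε (slope u) * quadraticChar k (scal u)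

lemma intCast_mul_single {H : Type*} [AddCommGroup H] (c : ℤ) (a : H) (b : ℤ) :
    (c : AddMonoidAlgebra ℤ H) * AddMonoidAlgebra.single a b =
      AddMonoidAlgebra.single a (c * b) := by
  rw [AddMonoidAlgebra.intCast_def, AddMonoidAlgebra.single_mul_single, zero_add, Int.cast_id]

lemma alg_lineSum (σ : Option k → ℤ) :
    alg (lineSum σ) = ∑ β, (σ β : AddMonoidAlgebra ℤ (k × k)) * lineHom β (alg 1) := by
  have h (β : Option k) : (σ β : AddMonoidAlgebra ℤ (k × k)) * lineHom β (alg 1) =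
      AddMonoidAlgebra.single 0 (σ β) +
        ∑ x : k with x ≠ 0, AddMonoidAlgebra.single (x • dir β) (σ β) := by
    rw [lineHom_alg, mul_sum, sum_eq_zero_add_sum_ne_zero]
    simp only [intCast_mul_single]
    simp
  simp only [h]
  rw [sum_add_distrib, sum_lines fun β x => AddMonoidAlgebra.single (x • dir β) (σ β), alg,
    sum_eq_zero_add_sum_ne_zero]
  congr 1
  · rw [lineSum, if_pos rfl]
    ext; simp [AddMonoidAlgebra.coeff_sum, Finsupp.single_apply]
  · refine sum_congr rfl fun u hu => ?_
    rw [scal_smul_dir, lineSum, if_neg (mem_filter.mp hu).2]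

lemma alg_halfLineSum (ε : Option k → ℤ) :
    alg (halfLineSum ε) =
      ∑ β, (ε β : AddMonoidAlgebra ℤ (k × k)) * lineHom β (alg (quadraticChar k)) := by
  have h (β : Option k) : (ε β : AddMonoidAlgebra ℤ (k × k)) * lineHom β (alg (quadraticChar k)) =
        ∑ x with x ≠ 0, AddMonoidAlgebra.single (x • dir β) (ε β * quadraticChar k x) := by
    rw [lineHom_alg, mul_sum, sum_eq_zero_add_sum_ne_zero]
    simp only [intCast_mul_single]
    simp
  simp only [h]
  rw [sum_lines fun β x => AddMonoidAlgebra.single (x • dir β) (ε β * quadraticChar k x), alg,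
    sum_eq_zero_add_sum_ne_zero]
  simp only [scal_smul_dir]
  simp [halfLineSum, scal_eq_zero.mpr]

end Plane

/-! ### Products of sums over lines -/

section PlaneProducts

variable {k : Type*} [Field k] [Fintype k] [DecidableEq k]

lemma alg_one_sq {H : Type*} [AddCommGroup H] [Fintype H] :
    (alg 1 : AddMonoidAlgebra ℤ H) * alg 1 = (Fintype.card H : AddMonoidAlgebra ℤ H) * alg 1 := by
  rw [alg_one_mul]; simp

lemma lineHom_one_mul (β γ : Option k) :
    lineHom β (alg (1 : k → ℤ)) * lineHom γ (alg 1) =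
      if β = γ then (Fintype.card k : AddMonoidAlgebra ℤ (k × k)) * lineHom β (alg 1)
      else alg 1 := by
  split_ifs with h
  · rw [← h, ← map_mul, alg_one_sq, map_mul, map_natCast]
  · rw [lineHom_mul_lineHom h]; congr 1

/-- Two distinct lines through the origin multiply to the sum of all vectors, and the square of a
line is `|k|` times the line. -/
lemma alg_lineSum_mul (σ τ : Option k → ℤ) :
    alg (lineSum σ) * alg (lineSum τ) =
      (Fintype.card k : AddMonoidAlgebra ℤ (k × k)) * alg (lineSum (σ * τ)) +
        (((∑ β, σ β) * (∑ β, τ β) - ∑ β, σ β * τ β : ℤ) : AddMonoidAlgebra ℤ (k × k)) *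
          alg 1 := by
  have h (β γ : Option k) : (σ β : AddMonoidAlgebra ℤ (k × k)) * lineHom β (alg 1) *
      ((τ γ : AddMonoidAlgebra ℤ (k × k)) * lineHom γ (alg 1)) =
      (σ β * τ γ : AddMonoidAlgebra ℤ (k × k)) * alg 1 +
        if β = γ then (σ β * τ γ : AddMonoidAlgebra ℤ (k × k)) *
          ((Fintype.card k : AddMonoidAlgebra ℤ (k × k)) * lineHom β (alg 1) - alg 1) else 0 := by
    rw [mul_mul_mul_comm, lineHom_one_mul]
    split_ifs <;> ring
  simp only [alg_lineSum, sum_mul_sum, h, sum_add_distrib, sum_ite_eq, mem_univ, if_true]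
  have e1 : ∑ β, ∑ γ, (σ β * τ γ : AddMonoidAlgebra ℤ (k × k)) * alg 1 =
      (∑ β, ∑ γ, (σ β * τ γ : AddMonoidAlgebra ℤ (k × k))) * alg 1 := by
    simp only [sum_mul]
  have e2 : ∑ β, (σ β * τ β : AddMonoidAlgebra ℤ (k × k)) *
      ((Fintype.card k : AddMonoidAlgebra ℤ (k × k)) * lineHom β (alg 1) - alg 1) =
      (Fintype.card k : AddMonoidAlgebra ℤ (k × k)) *
        ∑ β, (((σ * τ) β : ℤ) : AddMonoidAlgebra ℤ (k × k)) * lineHom β (alg 1) -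
      (∑ β, (σ β * τ β : AddMonoidAlgebra ℤ (k × k))) * alg 1 := by
    rw [mul_sum, sum_mul, ← sum_sub_distrib]
    exact sum_congr rfl fun β _ => by rw [Pi.mul_apply, Int.cast_mul]; ring
  rw [e1, e2]
  push_cast
  ring

lemma lineSum_one : lineSum (1 : Option k → ℤ) =
    (Fintype.card k : ℤ) • Pi.single 0 1 + 1 := by
  ext u
  by_cases hu : u = 0
  · simp [lineSum, hu]
  · simp [lineSum, hu]

lemma alg_lineSum_one : alg (lineSum (1 : Option k → ℤ)) =
    (Fintype.card k : AddMonoidAlgebra ℤ (k × k)) + alg 1 := by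
  have h : alg ((Fintype.card k : ℤ) • Pi.single (0 : k × k) (1 : ℤ)) =
      (Fintype.card k : AddMonoidAlgebra ℤ (k × k)) := by
    ext u; simp [coeff_alg, Pi.single_apply, Finsupp.single_apply, eq_comm]
  rw [lineSum_one, alg_add, h]

/-- Two families of signs on complementary sets of lines, both with sum `1`. -/
lemma alg_lineSum_sq_add_sq {σ τ : Option k → ℤ} (hστ : ∀ β, σ β ^ 2 + τ β ^ 2 = 1)
    (hσ : ∑ β, σ β = 1) (hτ : ∑ β, τ β = 1) :
    alg (lineSum σ) ^ 2 + alg (lineSum τ) ^ 2 =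
      (Fintype.card (k × k) : AddMonoidAlgebra ℤ (k × k)) + alg 1 := by
  have h1 : lineSum (σ * σ) + lineSum (τ * τ) = lineSum 1 := by
    ext u
    have h (β : Option k) : σ β * σ β + τ β * τ β = 1 := by rw [← hστ β]; ring
    by_cases hu : u = 0
    · simp only [lineSum, hu, if_true, Pi.add_apply, Pi.mul_apply, ← sum_add_distrib, h,
        Pi.one_apply]
    · simp only [lineSum, hu, if_false, Pi.add_apply, Pi.mul_apply, h, Pi.one_apply]
  have h2 : ∑ β, σ β * σ β + ∑ β, τ β * τ β = Fintype.card k + 1 := by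
    simp only [← sum_add_distrib, ← sq, hστ]; simp
  have h3 := congrArg alg h1
  rw [alg_add, alg_lineSum_one] at h3
  have h4 := congrArg (Int.cast : ℤ → AddMonoidAlgebra ℤ (k × k)) h2
  push_cast at h4
  rw [sq, sq, alg_lineSum_mul, alg_lineSum_mul, hσ, hτ, Fintype.card_prod]
  push_cast
  linear_combination (Fintype.card k : AddMonoidAlgebra ℤ (k × k)) * h3 - alg 1 * h4

/-- The function `u ↦ ∑ ε β * η (det (dir β) u)`; up to a factor, it is the Fourier transform of
`halfLineSum ε`, when vectors are identified with characters by means of `det`. -/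
def detSum (ε : Option k → ℤ) (u : k × k) : ℤ :=
  ∑ β, ε β * quadraticChar k (det (dir β) u)

lemma quadraticChar_det_swap (h1 : quadraticChar k (-1) = 1) (u v : k × k) :
    quadraticChar k (det u v) = quadraticChar k (det v u) := by
  rw [det_swap, ← neg_one_mul, map_mul, h1, one_mul]

/-- Copies of the quadratic character on two lines multiply to the pointwise product of
the quadratic characters of the linear forms that vanish on the lines, with a correction when the
lines coincide. -/
lemma lineHom_quadraticChar_mul (hk : ringChar k ≠ 2) (h1 : quadraticChar k (-1) = 1)
    (β γ : Option k) :
    lineHom β (alg (quadraticChar k)) * lineHom γ (alg (quadraticChar k)) =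
      alg (fun u => quadraticChar k (det (dir β) u) * quadraticChar k (det (dir γ) u)) +
        if β = γ then (Fintype.card k : AddMonoidAlgebra ℤ (k × k)) - alg 1 else 0 := by
  split_ifs with h
  · have h2 : (fun u => quadraticChar k (det (dir β) u) * quadraticChar k (det (dir β) u)) =
        1 - fun u => if det (dir β) u = 0 then 1 else 0 := by
      ext u
      by_cases hu : det (dir β) u = 0
      · simp [hu]
      · rw [← sq, quadraticChar_sq_one hu]; simp [hu]
    have h3 : lineHom β (alg 1) = alg fun u => if det (dir β) u = 0 then 1 else 0 := by
      rw [lineHom_alg, alg]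
      simp only [apply_ite (AddMonoidAlgebra.single _), AddMonoidAlgebra.single_zero]
      rw [← sum_filter]
      refine sum_nbij (fun x => x • dir β) ?_ ?_ ?_ fun _ _ => rfl
      · intro x _; simp [det_smul_right, det_dir_self]
      · intro x _ y _ hxy
        exact smul_left_injective k (dir_ne_zero β) hxy
      · intro u hu
        obtain ⟨x, rfl⟩ := det_dir_eq_zero (by simpa using hu)
        exact ⟨x, by simp, rfl⟩
    rw [← h, ← map_mul, ← sq, alg_quadraticChar_sq hk h1, map_sub, map_natCast, h2, alg_sub, h3]
    ring
  · rw [lineHom_mul_lineHom h, add_zero]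
    congr 1; ext u
    have hd := det_dir_ne_zero h
    have : quadraticChar k (det (dir β) (dir γ))⁻¹ * quadraticChar k (det (dir β) (dir γ))⁻¹
        = 1 := by rw [← sq, quadraticChar_sq_one (inv_ne_zero hd)]
    rw [div_eq_mul_inv, div_eq_mul_inv, map_mul, map_mul, quadraticChar_det_swap h1 u]
    linear_combination quadraticChar k (det (dir β) u) * quadraticChar k (det (dir γ) u) * this

lemma coeff_intCast_mul_alg {H : Type*} [AddCommGroup H] [Fintype H] (c : ℤ) (f : H → ℤ)
    (u : H) : ((c : AddMonoidAlgebra ℤ H) * alg f).coeff u = c * f u := by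
  rw [← zsmul_eq_mul, AddMonoidAlgebra.coeff_smul, Finsupp.smul_apply, coeff_alg, smul_eq_mul]

/-- The product of two half line sums is, up to a diagonal term, the pointwise product of their
Fourier transforms. -/
lemma alg_halfLineSum_mul (hk : ringChar k ≠ 2) (h1 : quadraticChar k (-1) = 1)
    (ε ε' : Option k → ℤ) :
    alg (halfLineSum ε) * alg (halfLineSum ε') = alg (detSum ε * detSum ε') +
      ((∑ β, ε β * ε' β : ℤ) : AddMonoidAlgebra ℤ (k × k)) *
        ((Fintype.card k : AddMonoidAlgebra ℤ (k × k)) - alg 1) := by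
  have h (β γ : Option k) : (ε β : AddMonoidAlgebra ℤ (k × k)) *
      lineHom β (alg (quadraticChar k)) * (ε' γ * lineHom γ (alg (quadraticChar k))) =
      (ε β * ε' γ : AddMonoidAlgebra ℤ (k × k)) *
        alg (fun u => quadraticChar k (det (dir β) u) * quadraticChar k (det (dir γ) u)) +
        if β = γ then (ε β * ε' γ : AddMonoidAlgebra ℤ (k × k)) *
          ((Fintype.card k : AddMonoidAlgebra ℤ (k × k)) - alg 1) else 0 := by
    rw [mul_mul_mul_comm, lineHom_quadraticChar_mul hk h1]
    split_ifs <;> ring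
  have h2 : alg (detSum ε * detSum ε') = ∑ β, ∑ γ, (ε β * ε' γ : AddMonoidAlgebra ℤ (k × k)) *
      alg (fun u => quadraticChar k (det (dir β) u) * quadraticChar k (det (dir γ) u)) := by
    simp only [← Int.cast_mul]
    ext u
    simp only [AddMonoidAlgebra.coeff_sum, Finsupp.finsetSum_apply, coeff_intCast_mul_alg,
      coeff_alg, Pi.mul_apply, detSum, sum_mul_sum]
    exact sum_congr rfl fun β _ => sum_congr rfl fun γ _ => by ring
  simp only [alg_halfLineSum, sum_mul_sum, h, sum_add_distrib, sum_ite_eq, mem_univ, if_true]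
  rw [h2]
  push_cast
  rw [sum_mul]

lemma lineHom_one_mul_quadraticChar (hk : ringChar k ≠ 2) (β γ : Option k) :
    lineHom β (alg (1 : k → ℤ)) * lineHom γ (alg (quadraticChar k)) =
      (quadraticChar k (det (dir β) (dir γ)) : AddMonoidAlgebra ℤ (k × k)) *
        alg (fun u => quadraticChar k (det (dir β) u)) := by
  by_cases h : β = γ
  · rw [← h, ← map_mul, alg_one_mul_quadraticChar hk, det_dir_self]; simp
  · rw [lineHom_mul_lineHom h]
    ext u
    have : quadraticChar k (det (dir β) (dir γ))⁻¹ = quadraticChar k (det (dir β) (dir γ)) := by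
      have h2 : (quadraticChar k)⁻¹ = quadraticChar k := (quadraticChar_isQuadratic k).inv
      rw [← MulChar.inv_apply', h2]
    rw [coeff_alg, coeff_intCast_mul_alg, div_eq_mul_inv _ (det (dir β) (dir γ)),
      div_eq_mul_inv _ (det (dir β) (dir γ)), map_mul (quadraticChar k), this, Pi.one_apply,
      one_mul, mul_comm]

lemma alg_lineSum_mul_halfLineSum (hk : ringChar k ≠ 2) (h1 : quadraticChar k (-1) = 1)
    (σ ε : Option k → ℤ) (h : ∀ β, σ β * detSum ε (dir β) = 0) :
    alg (lineSum σ) * alg (halfLineSum ε) = 0 := by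
  simp only [alg_lineSum, alg_halfLineSum, sum_mul_sum]
  refine sum_eq_zero fun β _ => ?_
  have h2 (γ : Option k) : (σ β : AddMonoidAlgebra ℤ (k × k)) * lineHom β (alg 1) *
      (ε γ * lineHom γ (alg (quadraticChar k))) =
      ((σ β * (ε γ * quadraticChar k (det (dir γ) (dir β))) : ℤ) : AddMonoidAlgebra ℤ (k × k)) *
        alg (fun u => quadraticChar k (det (dir β) u)) := by
    rw [mul_mul_mul_comm, lineHom_one_mul_quadraticChar hk, quadraticChar_det_swap h1]
    push_cast; ring
  simp only [h2]
  rw [← sum_mul, ← Int.cast_sum, ← mul_sum]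
  have := h β
  rw [detSum] at this
  rw [this]; simp

end PlaneProducts

/-! ### Pure seeds of order `q ^ 4` -/

section Signs

/-- On a finite set of odd size there are signs with sum `1`. -/
lemma exists_signs {α : Type*} [Fintype α] (P : α → Prop) [DecidablePred P]
    (hP : Odd (univ.filter P).card) :
    ∃ σ : α → ℤ, (∀ x, σ x ^ 2 = if P x then 1 else 0) ∧ ∑ x, σ x = 1 := by
  classical
  obtain ⟨m, hm⟩ := hP
  obtain ⟨T, hT, hTm⟩ := exists_subset_card_eq (show m ≤ (univ.filter P).card by omega)
  have hTP (x : α) (hx : x ∈ T) : P x := (mem_filter.mp (hT hx)).2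
  refine ⟨fun x => (if P x then 1 else 0) - 2 * if x ∈ T then 1 else 0, fun x => ?_, ?_⟩
  · by_cases hx : x ∈ T
    · simp [hx, hTP x hx]
    · by_cases hPx : P x <;> simp [hx, hPx]
  · rw [sum_sub_distrib, ← mul_sum, sum_boole, hm]
    simp [hTm]

/-- Given two functions with complementary supports of equal odd size, there are signs with sum `1`
on either support. -/
lemma exists_complementary_signs {α : Type*} [Fintype α] {f g : α → ℤ}
    (h : ∀ x, f x ^ 2 + g x ^ 2 = 1) (hfg : ∑ x, f x ^ 2 = ∑ x, g x ^ 2)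
    (hα : Fintype.card α % 4 = 2) :
    ∃ σ τ : α → ℤ, (∀ x, σ x ^ 2 = g x ^ 2) ∧ (∀ x, τ x ^ 2 = f x ^ 2) ∧
      ∑ x, σ x = 1 ∧ ∑ x, τ x = 1 := by
  have hsum : ∑ x, f x ^ 2 + ∑ x, g x ^ 2 = Fintype.card α := by
    simp only [← sum_add_distrib, h]; simp
  have key {f : α → ℤ} (hf : ∀ x, f x = 0 ∨ f x ^ 2 = 1)
      (h2 : 2 * ∑ x, f x ^ 2 = Fintype.card α) :
      ∃ τ : α → ℤ, (∀ x, τ x ^ 2 = f x ^ 2) ∧ ∑ x, τ x = 1 := by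
    have hind (x : α) : (if f x ≠ 0 then 1 else 0 : ℤ) = f x ^ 2 := by
      rcases hf x with h | h
      · simp [h]
      · have : f x ≠ 0 := by rintro h0; simp [h0] at h
        simp [this, h]
    have hcard : ((univ.filter fun x => f x ≠ 0).card : ℤ) = ∑ x, f x ^ 2 := by
      rw [card_filter]; push_cast
      exact sum_congr rfl fun x _ => hind x
    obtain ⟨τ, hτ, hτ1⟩ := exists_signs (fun x => f x ≠ 0) (by rw [Nat.odd_iff]; omega)
    exact ⟨τ, fun x => (hτ x).trans (hind x), hτ1⟩
  obtain ⟨σ, hσ, hσ1⟩ := key (f := g)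
    (fun x => (sq_add_sq_eq_one (h x)).elim (fun h => .inr h.2) fun h => .inl h.2) (by linarith)
  obtain ⟨τ, hτ, hτ1⟩ := key (f := f)
    (fun x => (sq_add_sq_eq_one (h x)).elim (fun h => .inl h.1) fun h => .inr h.1) (by linarith)
  exact ⟨σ, τ, hσ, hτ, hσ1, hτ1⟩

end Signs

section QuadraticExtension

variable {F K : Type*} [Field F] [Field K] [Fintype F] [Fintype K] [Algebra F K]

/-- Elements of a finite field are squares in its quadratic extension. -/
lemma isSquare_algebraMap (hK : Fintype.card K = Fintype.card F ^ 2) (h2 : ringChar K ≠ 2)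
    (hF : Odd (Fintype.card F)) (a : F) : IsSquare (algebraMap F K a) := by
  by_cases ha : a = 0
  · simp [ha]
  rw [FiniteField.isSquare_iff h2 (by simpa using ha), hK]
  obtain ⟨m, hm⟩ := hF
  have h : Fintype.card F ^ 2 / 2 = (Fintype.card F - 1) * (m + 1) := by
    rw [hm, show (2 * m + 1) ^ 2 = 2 * (2 * m * (m + 1)) + 1 by ring]
    have : 2 * m + 1 - 1 = 2 * m := rfl
    rw [this]; omega
  rw [h, pow_mul, ← map_pow, FiniteField.pow_card_sub_one_eq_one a ha, map_one, one_pow]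

/-- Coordinates on a quadratic extension, with prescribed first basis vector. -/
lemma exists_coordinates (hK : Fintype.card K = Fintype.card F ^ 2) {c : K} (hc : c ≠ 0) :
    ∃ (d : K) (e : F × F ≃ K), ∀ a b, e (a, b) = algebraMap F K a * c + algebraMap F K b * d := by
  classical
  have hlt : 1 < Fintype.card F := Fintype.one_lt_card
  obtain ⟨d, hd⟩ : ∃ d : K, ∀ a : F, algebraMap F K a * c ≠ d := by
    by_contra! h
    have := Fintype.card_le_of_surjective _ h
    rw [hK] at this
    nlinarith
  have hinj : Function.Injective
      fun p : F × F => algebraMap F K p.1 * c + algebraMap F K p.2 * d := by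
    rintro ⟨a, b⟩ ⟨a', b'⟩ h
    simp only at h
    by_cases hb : b = b'
    · subst hb
      have h1 := mul_right_cancel₀ hc (add_right_cancel h)
      rw [(algebraMap F K).injective h1]
    · have hb' : algebraMap F K b - algebraMap F K b' ≠ 0 := by
        rw [← map_sub, map_ne_zero]; exact sub_ne_zero.mpr hb
      refine absurd ?_ (hd ((a' - a) / (b - b')))
      rw [map_div₀, map_sub, map_sub, div_mul_eq_mul_div, div_eq_iff hb']
      linear_combination -h
  have hbij := (Fintype.bijective_iff_injective_and_card _).mpr
    ⟨hinj, by rw [Fintype.card_prod, hK, sq]⟩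
  exact ⟨d, Equiv.ofBijective _ hbij, fun a b => rfl⟩

variable [DecidableEq K]

lemma quadraticChar_algebraMap (hK : Fintype.card K = Fintype.card F ^ 2) (h2 : ringChar K ≠ 2)
    (hF : Odd (Fintype.card F)) {a : F} (ha : a ≠ 0) : quadraticChar K (algebraMap F K a) = 1 :=
  (quadraticChar_one_iff_isSquare (by simpa using ha)).mpr (isSquare_algebraMap hK h2 hF a)

variable [DecidableEq F]

/-- The sum of the quadratic character of a quadratic extension over a line `b d + F c`. -/
lemma sum_quadraticChar_line (hK : Fintype.card K = Fintype.card F ^ 2) (h2 : ringChar K ≠ 2)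
    (hF : Odd (Fintype.card F)) {c d : K} (e : F × F ≃ K)
    (he : ∀ a b, e (a, b) = algebraMap F K a * c + algebraMap F K b * d) (b : F) :
    ∑ a, quadraticChar K (algebraMap F K a * c + algebraMap F K b * d) =
      quadraticChar K c * ((if b = 0 then (Fintype.card F : ℤ) else 0) - 1) := by
  have h0 : ∑ a, quadraticChar K (algebraMap F K a * c + algebraMap F K 0 * d) =
      quadraticChar K c * (Fintype.card F - 1) := by
    have (a : F) : quadraticChar K (algebraMap F K a * c + algebraMap F K 0 * d) =
        quadraticChar K c - quadraticChar K c * if a = 0 then 1 else 0 := by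
      split_ifs with ha
      · simp [ha]
      · rw [map_zero, zero_mul, add_zero, map_mul, quadraticChar_algebraMap hK h2 hF ha]; simp
    rw [sum_congr rfl fun a _ => this a]
    simp; ring
  have h1 {b : F} (hb : b ≠ 0) :
      ∑ a, quadraticChar K (algebraMap F K a * c + algebraMap F K b * d) =
        ∑ a, quadraticChar K (algebraMap F K a * c + algebraMap F K 1 * d) := by
    rw [← Equiv.sum_comp (Equiv.mulLeft₀ b hb)]
    refine sum_congr rfl fun a _ => ?_
    have : algebraMap F K (b * a) * c + algebraMap F K b * d =
        algebraMap F K b * (algebraMap F K a * c + algebraMap F K 1 * d) := by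
      rw [map_mul, map_one]; ring
    rw [Equiv.mulLeft₀_apply, this, map_mul, quadraticChar_algebraMap hK h2 hF hb, one_mul]
  have hlt : 1 < Fintype.card F := Fintype.one_lt_card
  by_cases hb : b = 0
  · rw [hb, h0, if_pos rfl]
  · have htot := quadraticChar_sum_zero (F := K) h2
    rw [← Equiv.sum_comp e, Fintype.sum_prod_type_right] at htot
    simp only [he] at htot
    rw [sum_eq_zero_add_sum_ne_zero, h0,
      sum_congr rfl fun b hb => h1 (mem_filter.mp hb).2, sum_const, nsmul_eq_mul] at htot
    have hcard : (((univ.filter fun x : F => x ≠ 0).card : ℕ) : ℤ) = Fintype.card F - 1 := by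
      rw [filter_ne', card_erase_of_mem (mem_univ _), card_univ]; push_cast [hlt.le]; ring
    rw [hcard, mul_comm (quadraticChar K c), ← mul_add] at htot
    rw [h1 hb, if_neg hb]
    rcases mul_eq_zero.mp htot with h | h
    · omega
    · linarith

/-- For each `c` there is a sign vector indexed by the projective line which is an eigenvector of
the matrix `η (det (dir β) (dir γ))` with eigenvalue `η c * q`. -/
lemma exists_eigenvector (hK : Fintype.card K = Fintype.card F ^ 2) (h2 : ringChar K ≠ 2)
    (hF : Odd (Fintype.card F)) {c : K} (hc : c ≠ 0) :
    ∃ y : Option K → ℤ, (∀ β, y β ^ 2 = 1) ∧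
      ∀ γ, detSum y (dir γ) = quadraticChar K c * Fintype.card F * y γ := by
  have hm : quadraticChar K (-1) = 1 := by
    have := quadraticChar_algebraMap (K := K) hK h2 hF (a := -1) (by simp)
    rwa [map_neg, map_one] at this
  have hc2 : quadraticChar K c ^ 2 = 1 := quadraticChar_sq_one hc
  obtain ⟨d, e, he⟩ := exists_coordinates (F := F) hK hc
  obtain ⟨s, hs, hsum⟩ := exists_signs (fun _ : F => True) (by simpa using hF)
  simp only [if_true] at hs
  -- The vector is constant on the cosets of the line `F c`; the sums over them are known.
  refine ⟨fun β => β.elim 1 fun x => quadraticChar K c * s (e.symm x).2, ?_, ?_⟩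
  · rintro (_ | x)
    · simp
    · simp only [Option.elim, mul_pow, hc2, hs, mul_one]
  · intro γ
    rw [detSum, Fintype.sum_option, ← Equiv.sum_comp e, Fintype.sum_prod_type_right]
    rcases γ with _ | x
    · simp only [Option.elim, det, dir, Equiv.symm_apply_apply]
      simp [← mul_sum, hsum]
      ring
    · obtain ⟨⟨a₀, b₀⟩, rfl⟩ := e.surjective x
      have h (a b : F) : det (dir (some (e (a, b)))) (dir (some (e (a₀, b₀)))) =
          algebraMap F K (a₀ - a) * c + algebraMap F K (b₀ - b) * d := by
        simp only [det, dir, he, map_sub]; ring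
      simp only [Option.elim, Equiv.symm_apply_apply, h, ← mul_sum]
      have h3 (b : F) : ∑ a, quadraticChar K
          (algebraMap F K (a₀ - a) * c + algebraMap F K (b₀ - b) * d) =
          quadraticChar K c * ((if b = b₀ then (Fintype.card F : ℤ) else 0) - 1) := by
        refine (Equiv.sum_comp (Equiv.subLeft a₀) fun a => quadraticChar K
          (algebraMap F K a * c + algebraMap F K (b₀ - b) * d)).trans ?_
        rw [sum_quadraticChar_line hK h2 hF e he]
        simp only [sub_eq_zero, eq_comm]
      have h4 : quadraticChar K (det (dir none) (dir (some (e (a₀, b₀))))) = 1 := by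
        simpa [det, dir] using hm
      simp only [h3, h4]
      have h5 (b : F) : quadraticChar K c * s b *
          (quadraticChar K c * ((if b = b₀ then (Fintype.card F : ℤ) else 0) - 1)) =
          quadraticChar K c ^ 2 * ((if b = b₀ then s b * Fintype.card F else 0) - s b) := by
        split_ifs <;> ring
      simp only [h5]
      rw [← mul_sum, sum_sub_distrib, hsum, sum_ite_eq' univ b₀, if_pos (mem_univ _), hc2]
      linear_combination (-1 * s b₀ * Fintype.card F) * hc2

/-- The sum and the difference of eigenvectors for the eigenvalues `q` and `-q`: two functions with
complementary supports which the matrix `η (det (dir β) (dir γ))` interchanges up to the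
factor `q`. -/
lemma exists_interchanged (hK : Fintype.card K = Fintype.card F ^ 2) (h2 : ringChar K ≠ 2)
    (hF : Odd (Fintype.card F)) :
    ∃ ε ε' : Option K → ℤ, (∀ β, ε β ^ 2 + ε' β ^ 2 = 1) ∧
      (∀ γ, detSum ε (dir γ) = Fintype.card F * ε' γ) ∧
      ∀ γ, detSum ε' (dir γ) = Fintype.card F * ε γ := by
  obtain ⟨c, hc⟩ := quadraticChar_exists_neg_one (F := K) h2
  have hc0 : c ≠ 0 := by rintro rfl; simp at hc
  obtain ⟨y, hy, hCy⟩ := exists_eigenvector (F := F) hK h2 hF (one_ne_zero (α := K))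
  obtain ⟨z, hz, hCz⟩ := exists_eigenvector (F := F) hK h2 hF hc0
  have hyz (β : Option K) : ∃ a b : ℤ, a ^ 2 + b ^ 2 = 1 ∧ y β = a + b ∧ z β = a - b := by
    rcases sq_eq_one_iff.mp (hy β) with h | h <;>
    rcases sq_eq_one_iff.mp (hz β) with h' | h'
    · exact ⟨1, 0, by simp [h, h']⟩
    · exact ⟨0, 1, by simp [h, h']⟩
    · exact ⟨0, -1, by simp [h, h']⟩
    · exact ⟨-1, 0, by simp [h, h']⟩
  choose ε ε' h1 h3 h4 using hyz
  have hdy (γ : Option K) : detSum y (dir γ) = detSum ε (dir γ) + detSum ε' (dir γ) := by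
    simp only [detSum, h3, add_mul, sum_add_distrib]
  have hdz (γ : Option K) : detSum z (dir γ) = detSum ε (dir γ) - detSum ε' (dir γ) := by
    simp only [detSum, h4, sub_mul, sum_sub_distrib]
  refine ⟨ε, ε', h1, fun γ => ?_, fun γ => ?_⟩ <;>
  · have a1 := hCy γ
    have a2 := hCz γ
    rw [map_one, hdy, h3] at a1
    rw [hc, hdz, h4] at a2
    linarith

end QuadraticExtension

section PlaneFunctions

variable {k : Type*} [Field k] [DecidableEq k]

lemma slope_neg (u : k × k) : slope (-u) = slope u := by
  simp [slope]

lemma scal_neg (u : k × k) : scal (-u) = -scal u := by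
  unfold scal; simp; split_ifs <;> rfl

variable [Fintype k]

lemma lineSum_neg (σ : Option k → ℤ) (u : k × k) : lineSum σ (-u) = lineSum σ u := by
  simp [lineSum, slope_neg]

lemma halfLineSum_neg (h1 : quadraticChar k (-1) = 1) (ε : Option k → ℤ) (u : k × k) :
    halfLineSum ε (-u) = halfLineSum ε u := by
  rw [halfLineSum, slope_neg, scal_neg, ← neg_one_mul (scal u), map_mul, h1, one_mul, halfLineSum]

lemma halfLineSum_zero (ε : Option k → ℤ) : halfLineSum ε 0 = 0 := by
  simp [halfLineSum, scal_eq_zero.mpr]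

lemma halfLineSum_sq (ε : Option k → ℤ) {u : k × k} (hu : u ≠ 0) :
    halfLineSum ε u ^ 2 = ε (slope u) ^ 2 := by
  rw [halfLineSum, mul_pow, quadraticChar_sq_one (scal_eq_zero.not.mpr hu), mul_one]

lemma detSum_eq_halfLineSum {ε ε' : Option k → ℤ} {q : ℤ}
    (h : ∀ γ, detSum ε (dir γ) = q * ε' γ) (u : k × k) : detSum ε u = q * halfLineSum ε' u := by
  have : detSum ε u = quadraticChar k (scal u) * detSum ε (dir (slope u)) := by
    conv_lhs => rw [← scal_smul_dir u]
    simp only [detSum, det_smul_right, map_mul, mul_sum]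
    exact sum_congr rfl fun β _ => by ring
  rw [this, h, halfLineSum]; ring

lemma alg_sq_halfLineSum (ε : Option k → ℤ) :
    alg (fun u => halfLineSum ε u ^ 2) = alg (lineSum (ε ^ 2)) -
      ((∑ β, ε β ^ 2 : ℤ) : AddMonoidAlgebra ℤ (k × k)) := by
  ext u
  rw [AddMonoidAlgebra.intCast_def]
  simp only [coeff_alg, AddMonoidAlgebra.coeff_sub, Finsupp.sub_apply,
    AddMonoidAlgebra.coeff_single, Finsupp.single_apply]
  by_cases hu : u = 0
  · simp [hu, halfLineSum_zero, lineSum]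
  · simp [hu, Ne.symm hu, halfLineSum_sq, lineSum]

lemma alg_lineSum_add (σ τ : Option k → ℤ) :
    alg (lineSum (σ + τ)) = alg (lineSum σ) + alg (lineSum τ) := by
  simp only [alg_lineSum, Pi.add_apply, Int.cast_add, add_mul, sum_add_distrib]

end PlaneFunctions

section PureFour

variable {F K : Type*} [Field F] [Field K] [Fintype F] [Fintype K] [Algebra F K]

/-- A pure seed on the plane over a quadratic extension `K` of a finite field `F` of odd order. -/
theorem exists_isPureSeed_plane (hK : Fintype.card K = Fintype.card F ^ 2) (h2 : ringChar K ≠ 2)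
    (hF : Odd (Fintype.card F)) : ∃ w₁ w₂ r₁ r₂ : K × K → ℤ, IsPureSeed w₁ w₂ r₁ r₂ := by
  classical
  have hm : quadraticChar K (-1) = 1 := by
    have := quadraticChar_algebraMap (K := K) hK h2 hF (a := -1) (by simp)
    rwa [map_neg, map_one] at this
  obtain ⟨ε, ε', h1, hε, hε'⟩ := exists_interchanged (F := F) hK h2 hF
  have hq : (Fintype.card F : ℤ) ≠ 0 := by simp
  set q : ℤ := (Fintype.card F : ℤ) with hqdef
  -- The matrix `η (det (dir β) (dir γ))` is symmetric, so `ε` and `ε'` have supports of equal size.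
  have hN : ∑ β, ε β ^ 2 = ∑ β, ε' β ^ 2 := by
    have e1 : ∑ γ, ε' γ * detSum ε (dir γ) = ∑ γ, ε γ * detSum ε' (dir γ) := by
      simp only [detSum, mul_sum]
      rw [sum_comm]
      refine sum_congr rfl fun β _ => sum_congr rfl fun γ _ => ?_
      rw [quadraticChar_det_swap hm]; ring
    simp only [hε, hε'] at e1
    have e2 (f : Option K → ℤ) : ∑ γ, f γ * (q * f γ) = q * ∑ γ, f γ ^ 2 := by
      rw [mul_sum]; exact sum_congr rfl fun γ _ => by ring
    rw [e2, e2] at e1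
    exact (mul_left_cancel₀ hq e1).symm
  have hsum : ∑ β, ε β ^ 2 + ∑ β, ε' β ^ 2 = q ^ 2 + 1 := by
    simp only [← sum_add_distrib, h1]
    simp [hK, hqdef]
  have hval (β : Option K) : (ε β = 0 ∧ ε' β ^ 2 = 1) ∨ (ε β ^ 2 = 1 ∧ ε' β = 0) :=
    sq_add_sq_eq_one (h1 β)
  obtain ⟨σ, τ, hσ', hτ', hσ1, hτ1⟩ := exists_complementary_signs h1 hN (by
    obtain ⟨m, hm⟩ := hF
    rw [Fintype.card_option, hK, hm, show (2 * m + 1) ^ 2 + 1 = 4 * (m ^ 2 + m) + 2 by ring]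
    omega)
  have hεε' (β : Option K) : ε β * ε' β = 0 := by rcases hval β with h | h <;> simp [h]
  have hσε (β : Option K) : σ β * ε β = 0 := by
    rw [← pow_eq_zero_iff two_ne_zero, mul_pow, hσ', ← mul_pow, mul_comm, hεε']; rfl
  have hτε (β : Option K) : τ β * ε' β = 0 := by
    rw [← pow_eq_zero_iff two_ne_zero, mul_pow, hτ', ← mul_pow, hεε']; rfl
  have hστ (β : Option K) : σ β * τ β = 0 := by
    rw [← pow_eq_zero_iff two_ne_zero, mul_pow, hσ', hτ', ← mul_pow, mul_comm, hεε']; rfl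
  have hdε := detSum_eq_halfLineSum hε
  have hdε' := detSum_eq_halfLineSum hε'
  have hQ : (Fintype.card K : AddMonoidAlgebra ℤ (K × K)) =
      (q : AddMonoidAlgebra ℤ (K × K)) ^ 2 := by
    rw [hK, hqdef]; push_cast; rfl
  -- The Fourier transform of a half line sum is a half line sum on the complementary lines.
  have hsq {f g : Option K → ℤ} (hf : ∀ u, detSum f u = q * halfLineSum g u)
      (hfg : ∑ β, f β ^ 2 = ∑ β, g β ^ 2) : alg (halfLineSum f) ^ 2 =
      (q : AddMonoidAlgebra ℤ (K × K)) ^ 2 * alg (lineSum (g ^ 2)) -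
        ((∑ β, g β ^ 2 : ℤ) : AddMonoidAlgebra ℤ (K × K)) * alg 1 := by
    have e1 : alg (detSum f * detSum f) = ((q ^ 2 : ℤ) : AddMonoidAlgebra ℤ (K × K)) *
        alg (fun u => halfLineSum g u ^ 2) := by
      ext u
      rw [coeff_intCast_mul_alg, coeff_alg, Pi.mul_apply, hf]; ring
    rw [sq, alg_halfLineSum_mul h2 hm, e1, alg_sq_halfLineSum, hQ]
    simp only [← sq, hfg]
    push_cast; ring
  have hlsq {f g : Option K → ℤ} (hf : ∀ β, f β ^ 2 = g β ^ 2) (hf1 : ∑ β, f β = 1) :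
      alg (lineSum f) ^ 2 = (q : AddMonoidAlgebra ℤ (K × K)) ^ 2 * alg (lineSum (g ^ 2)) +
        (1 - ((∑ β, g β ^ 2 : ℤ) : AddMonoidAlgebra ℤ (K × K))) * alg 1 := by
    have e1 : f * f = g ^ 2 := by ext β; simp only [Pi.mul_apply, Pi.pow_apply, ← hf, sq]
    rw [sq, alg_lineSum_mul, e1, hf1, hQ]
    simp only [← sq, hf]
    push_cast; ring
  have hsupp {f g : Option K → ℤ} (hf1 : ∑ β, f β = 1) (h : ∀ β, f β ^ 2 + g β ^ 2 = 1)
      (u : K × K) : lineSum f u ^ 2 + halfLineSum g u ^ 2 = 1 := by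
    by_cases hu : u = 0
    · rw [hu, halfLineSum_zero, lineSum, if_pos rfl, hf1]; rfl
    · rw [halfLineSum_sq g hu, lineSum, if_neg hu, h]
  refine ⟨lineSum σ, lineSum τ, halfLineSum ε, halfLineSum ε', ?_⟩
  constructor
  · exact lineSum_neg σ
  · exact lineSum_neg τ
  · exact halfLineSum_neg hm ε
  · exact halfLineSum_neg hm ε'
  · exact hsupp hσ1 fun β => by rw [hσ', add_comm, h1]
  · exact hsupp hτ1 fun β => by rw [hτ', h1]
  · exact halfLineSum_zero ε
  · exact halfLineSum_zero ε'
  · intro u hu; rw [halfLineSum_sq ε hu, halfLineSum_sq ε' hu, h1]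
  · rw [hlsq hσ' hσ1, hsq hdε hN]; ring
  · rw [hlsq hτ' hτ1, hsq hdε' hN.symm]; ring
  · rw [alg_lineSum_mul, hσ1, hτ1, show σ * τ = 0 from funext hστ]
    simp [hστ, alg_lineSum]
  · exact alg_lineSum_mul_halfLineSum h2 hm _ _ fun β => by
      rw [hε', mul_left_comm, hσε, mul_zero]
  · exact alg_lineSum_mul_halfLineSum h2 hm _ _ fun β => by
      rw [hε, mul_left_comm, hτε, mul_zero]
  · rw [alg_halfLineSum_mul h2 hm]
    have e1 : detSum ε * detSum ε' = 0 := by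
      ext u
      have := hεε' (slope u)
      rw [Pi.mul_apply, hdε, hdε', halfLineSum, halfLineSum, Pi.zero_apply]
      linear_combination q ^ 2 * quadraticChar K (scal u) ^ 2 * this
    rw [e1]
    simp [hεε', alg]
  · have e1 : ε ^ 2 + ε' ^ 2 = 1 := funext h1
    have e2 := alg_lineSum_add (ε ^ 2) (ε' ^ 2)
    rw [e1, alg_lineSum_one] at e2
    have e3 := congrArg (Int.cast : ℤ → AddMonoidAlgebra ℤ (K × K)) hsum
    rw [hQ] at e2
    rw [hsq hdε hN, hsq hdε' hN.symm, Fintype.card_prod, Nat.cast_mul, hQ]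
    push_cast at e3 ⊢
    linear_combination (-(q : AddMonoidAlgebra ℤ (K × K)) ^ 2) * e2 - alg 1 * e3

end PureFour

/-! ### Seeds of order `q ^ 2` from quartic characters -/

section Quartic

lemma isPrimitiveRoot_gaussianInt : IsPrimitiveRoot (⟨0, 1⟩ : GaussianInt) 4 := by
  rw [IsPrimitiveRoot.iff_def]
  have h2 : (⟨0, 1⟩ : GaussianInt) ^ 2 = -1 := by decide
  have h4 : (⟨0, 1⟩ : GaussianInt) ^ 4 = 1 := by decide
  refine ⟨h4, fun l hl => ?_⟩
  have hmod : (⟨0, 1⟩ : GaussianInt) ^ (l % 4) = 1 := by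
    rw [← hl]; conv_rhs => rw [← Nat.div_add_mod l 4, pow_add, pow_mul, h4, one_pow, one_mul]
  have hlt := Nat.mod_lt l (show 4 > 0 by norm_num)
  refine Nat.dvd_of_mod_eq_zero ?_
  generalize l % 4 = r at *
  interval_cases r
  · rfl
  all_goals exact absurd hmod (by decide)

section Values

variable {K : Type*} [Field K]

lemma exists_quartic_mulChar [Fintype K] (h4 : 4 ∣ Fintype.card K - 1) :
    ∃ ψ : MulChar K GaussianInt, ψ ^ 4 = 1 ∧ ψ ^ 2 ≠ 1 := by
  obtain ⟨ψ, hψ⟩ := MulChar.exists_mulChar_orderOf K h4 isPrimitiveRoot_gaussianInt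
  refine ⟨ψ, by rw [← hψ, pow_orderOf_eq_one], fun h => ?_⟩
  have := orderOf_dvd_of_pow_eq_one h
  rw [hψ] at this
  omega

lemma re_sum {ι : Type*} (s : Finset ι) (f : ι → GaussianInt) :
    (∑ i ∈ s, f i).re = ∑ i ∈ s, (f i).re :=
  map_sum (AddMonoidHom.mk' Zsqrtd.re fun _ _ => rfl) f s

lemma re_sq_add_im_sq (ψ : MulChar K GaussianInt) {x : K} (hx : x ≠ 0) :
    (ψ x).re ^ 2 + (ψ x).im ^ 2 = 1 := by
  have h := (Zsqrtd.norm_eq_one_iff' (by norm_num) _).mpr (hx.isUnit.map ψ)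
  rw [Zsqrtd.norm_def] at h
  linarith

lemma inv_apply_eq_star (ψ : MulChar K GaussianInt) (x : K) : ψ⁻¹ x = star (ψ x) := by
  by_cases hx : x = 0
  · rw [hx, MulChar.map_zero, MulChar.map_zero, star_zero]
  · have hu : IsUnit x := isUnit_iff_ne_zero.mpr hx
    have h1 : ψ x * ψ⁻¹ x = 1 := by
      rw [← MulChar.mul_apply, mul_inv_cancel, MulChar.one_apply hu]
    have h2 : ψ x * star (ψ x) = 1 := by
      rw [← Zsqrtd.norm_eq_mul_conj,
        (Zsqrtd.norm_eq_one_iff' (by norm_num) _).mpr (hu.map ψ), Int.cast_one]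
    exact mul_left_cancel₀ (left_ne_zero_of_mul_eq_one h1) (h1.trans h2.symm)

end Values

variable {F K : Type*} [Field F] [Field K] [Fintype F] [Fintype K] [Algebra F K]

lemma quartic_algebraMap_sq (hK : Fintype.card K = Fintype.card F ^ 2) (h2 : ringChar K ≠ 2)
    (hF : Odd (Fintype.card F)) {ψ : MulChar K GaussianInt} (h4 : ψ ^ 4 = 1) {a : F}
    (ha : a ≠ 0) : ψ (algebraMap F K a) ^ 2 = 1 := by
  obtain ⟨s, hs⟩ := isSquare_algebraMap hK h2 hF a
  have hs0 : s ≠ 0 := by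
    rintro rfl
    exact ha (by simpa using hs)
  rw [hs, map_mul, ← sq, ← pow_mul, ← MulChar.pow_apply' _ (by norm_num), h4,
    MulChar.one_apply hs0.isUnit]

variable [DecidableEq F] [DecidableEq K]

/-- A seed on the quadratic extension of a field of order `q ≡ 1 [MOD 4]`, made of the real and
imaginary parts of a quartic character `ψ` and of two signed families of lines.  As `ψ` takes real
values on the subfield, it is either real or purely imaginary on each line. -/
theorem exists_isSeed_plane (hK : Fintype.card K = Fintype.card F ^ 2) (h2 : ringChar K ≠ 2)
    (hF : Fintype.card F % 4 = 1) : ∃ w₁ w₂ r₁ r₂ e : F × F → ℤ, IsSeed w₁ w₂ r₁ r₂ e := by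
  have hodd : Odd (Fintype.card F) := Nat.odd_iff.mpr (by omega)
  obtain ⟨ψ, hψ4, hψ2⟩ := exists_quartic_mulChar (K := K) (by
    rw [hK]
    obtain ⟨m, hm⟩ : ∃ m, Fintype.card F = 4 * m + 1 := ⟨Fintype.card F / 4, by omega⟩
    exact ⟨4 * m ^ 2 + 2 * m, by rw [hm]; zify; simp; ring⟩)
  have hψ1 : ψ ≠ 1 := by rintro rfl; simp at hψ2
  have hη1 : quadraticChar K (-1) = 1 := by
    have := quadraticChar_algebraMap (K := K) hK h2 hodd (a := -1) (by simp)
    rwa [map_neg, map_one] at this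
  have hψm : ψ (-1) = 1 := by
    obtain ⟨t, ht⟩ := FiniteField.isSquare_neg_one_iff.mpr (by omega : Fintype.card F % 4 ≠ 3)
    have ht0 : t ≠ 0 := by rintro rfl; simp at ht
    have := quartic_algebraMap_sq hK h2 hodd hψ4 ht0
    rwa [← map_pow, ← map_pow, sq, ← ht, map_neg, map_one] at this
  obtain ⟨d, e, he⟩ := exists_coordinates (F := F) hK (one_ne_zero (α := K))
  have he' (u : F × F) : e u = algebraMap F K u.1 * 1 + algebraMap F K u.2 * d := he u.1 u.2
  have he0 : e 0 = 0 := by simp [he']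
  have he_eq_zero {u : F × F} (hu : u ≠ 0) : e u ≠ 0 := fun h => hu (e.injective (h.trans he0.symm))
  have he_neg (u : F × F) : e (-u) = -1 * e u := by simp [he']; ring
  have he_sub (u v : F × F) : e (u - v) = e u - e v := by simp [he']; ring
  have he_smul (x : F) (u : F × F) : e (x • u) = algebraMap F K x * e u := by simp [he']; ring
  have hψ_even (u : F × F) : ψ (e (-u)) = ψ (e u) := by rw [he_neg, map_mul, hψm, one_mul]
  have hψ_smul {x : F} (hx : x ≠ 0) (u : F × F) :
      ψ (e (x • u)) = ψ (e u) ∨ ψ (e (x • u)) = -ψ (e u) := by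
    rw [he_smul, map_mul]
    rcases sq_eq_one_iff.mp (quartic_algebraMap_sq hK h2 hodd hψ4 hx) with h | h <;> simp [h]
  have hψ_slope {u : F × F} (hu : u ≠ 0) :
      (ψ (e u)).re ^ 2 = (ψ (e (dir (slope u)))).re ^ 2 ∧
        (ψ (e u)).im ^ 2 = (ψ (e (dir (slope u)))).im ^ 2 := by
    have := hψ_smul (scal_eq_zero.not.mpr hu) (dir (slope u))
    rw [scal_smul_dir] at this
    rcases this with h | h <;> simp [h]
  have hdir (β : Option F) := re_sq_add_im_sq ψ (he_eq_zero (dir_ne_zero β))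
  -- Both kinds of lines are equally frequent, because `ψ ^ 2` has sum zero.
  have hbal : ∑ β, (ψ (e (dir β))).re ^ 2 = ∑ β, (ψ (e (dir β))).im ^ 2 := by
    have h0 : ∑ x, (ψ x) ^ 2 = 0 := by
      rw [← MulChar.sum_eq_zero_of_ne_one hψ2]
      exact sum_congr rfl fun x _ => by rw [MulChar.pow_apply' _ two_ne_zero]
    rw [← Equiv.sum_comp e, sum_eq_zero_add_sum_ne_zero, he0] at h0
    have h3 (β : Option F) : ∑ x : F with x ≠ 0, ψ (e (x • dir β)) ^ 2 =
        (Fintype.card F - 1) * ψ (e (dir β)) ^ 2 := by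
      have : ∀ x ∈ univ.filter fun x : F => x ≠ 0,
          ψ (e (x • dir β)) ^ 2 = ψ (e (dir β)) ^ 2 := fun x hx => by
        rcases hψ_smul (mem_filter.mp hx).2 (dir β) with h | h <;> simp [h]
      rw [sum_congr rfl this, sum_const, nsmul_eq_mul, filter_ne', card_erase_of_mem (mem_univ _),
        card_univ, Nat.cast_sub Fintype.card_pos, Nat.cast_one]
    have h4 := sum_lines fun (β : Option F) (x : F) => ψ (e (x • dir β)) ^ 2
    simp only [scal_smul_dir, h3, ← mul_sum] at h4
    rw [← h4, MulChar.map_zero, zero_pow two_ne_zero, zero_add] at h0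
    have hne : (Fintype.card F - 1 : GaussianInt) ≠ 0 := by
      rw [sub_ne_zero]
      exact_mod_cast (Fintype.one_lt_card (α := F)).ne'
    have h5 := congrArg Zsqrtd.re ((mul_eq_zero.mp h0).resolve_left hne)
    rw [re_sum, Zsqrtd.re_zero] at h5
    rw [← sub_eq_zero, ← sum_sub_distrib, ← h5]
    refine sum_congr rfl fun β _ => ?_
    simp [sq]; ring
  obtain ⟨σ, τ, hσ, hτ, hσ1, hτ1⟩ := exists_complementary_signs hdir hbal (by
    rw [Fintype.card_option]; omega)
  have hsupp {f : Option F → ℤ} {R : F × F → ℤ} (hf1 : ∑ β, f β = 1) (hR : R 0 = 0)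
      (h : ∀ u, u ≠ 0 → f (slope u) ^ 2 + R u ^ 2 = 1) (u : F × F) :
      lineSum f u ^ 2 + R u ^ 2 = 1 := by
    by_cases hu : u = 0
    · rw [hu, hR, lineSum, if_pos rfl, hf1]; rfl
    · rw [lineSum, if_neg hu, h u hu]
  have hstar (a b : GaussianInt) : (a * star b).re = a.re * b.re + a.im * b.im := by
    simp
  have hcard : Fintype.card (F × F) = Fintype.card K := by rw [Fintype.card_prod, hK, sq]
  refine ⟨lineSum σ, lineSum τ, fun u => (ψ (e u)).re, fun u => (ψ (e u)).im,
    fun u => quadraticChar K (e u), ?_⟩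
  constructor
  · exact lineSum_neg σ
  · exact lineSum_neg τ
  · intro u; rw [hψ_even]
  · intro u; rw [hψ_even]
  · intro u; rw [he_neg, map_mul, hη1, one_mul]
  · refine hsupp hσ1 (by rw [he0, MulChar.map_zero, Zsqrtd.re_zero]) fun u hu => ?_
    rw [hσ, (hψ_slope hu).1, add_comm, hdir]
  · refine hsupp hτ1 (by rw [he0, MulChar.map_zero, Zsqrtd.im_zero]) fun u hu => ?_
    rw [hτ, (hψ_slope hu).2, hdir]
  · simp [he0]
  · intro u hu; exact quadraticChar_sq_one (he_eq_zero hu)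
  · exact alg_lineSum_sq_add_sq (fun β => by rw [hσ, hτ, add_comm, hdir]) hσ1 hτ1
  · ext u
    simp only [sq, AddMonoidAlgebra.coeff_add, AddMonoidAlgebra.coeff_sub, Finsupp.add_apply,
      Finsupp.sub_apply, coeff_alg_mul, coeff_alg, AddMonoidAlgebra.coeff_natCast,
      Finsupp.single_apply, Pi.one_apply, ← sum_add_distrib, ← hstar, ← inv_apply_eq_star, he_sub]
    rw [← re_sum, Equiv.sum_comp e fun x => ψ x * ψ⁻¹ (e u - x), hcard]
    by_cases hu : u = 0
    · rw [hu, he0, sum_mulChar_mul_inv_zero hψm]; simp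
    · rw [sum_mulChar_mul_inv hψ1 hψm (he_eq_zero hu)]; simp [Ne.symm hu]
  · ext u
    have h := congrArg (fun a => a.coeff (e u)) (alg_quadraticChar_sq h2 hη1)
    simp only [sq, AddMonoidAlgebra.coeff_sub, Finsupp.sub_apply, coeff_alg_mul, coeff_alg,
      AddMonoidAlgebra.coeff_natCast, Finsupp.single_apply, Pi.one_apply, he_sub] at h ⊢
    rw [Equiv.sum_comp e fun x => quadraticChar K x * quadraticChar K (e u - x), h, hcard]
    by_cases hu : u = 0
    · simp [hu, he0]
    · simp [Ne.symm hu, (he_eq_zero hu).symm]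

end Quartic

/-! ### Three sporadic orders -/

section Sporadic

/-- The sign function on `ZMod n` which is `-1` at those `x` for which the binary digit of `m` of
weight `2 ^ x` is `1`. -/
def digitSign {n : ℕ} (m : ℕ) (x : ZMod n) : ℤ := if m.testBit x.val then -1 else 1

/-- The sign function of the block that meets `0 × ZMod n` and `1 × ZMod n` in the sets encoded by
`X i` and `Y i`. -/
def digitBlock {n : ℕ} (X Y : Fin 4 → ℕ) (i : Fin 4) : ZMod 2 × ZMod n → ℤ :=
  glue (digitSign (X i)) (digitSign (Y i))

lemma digitBlock_sq {n : ℕ} (X Y : Fin 4 → ℕ) (i : Fin 4) (p : ZMod 2 × ZMod n) :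
    digitBlock X Y i p ^ 2 = 1 := by
  refine glue_sq ?_ ?_ p <;> intro t <;> unfold digitSign <;> split_ifs <;> rfl

theorem exists_isTypeHStar_five :
    ∃ B : Fin 4 → Finset (ZMod 2 × ZMod 5), IsTypeHStar B :=
  exists_isTypeHStar_of_correlation (digitBlock ![23, 5, 13, 13] ![1, 3, 3, 3])
    (digitBlock_sq _ _) (by decide +kernel)

theorem exists_isTypeHStar_thirteen :
    ∃ B : Fin 4 → Finset (ZMod 2 × ZMod 13), IsTypeHStar B :=
  exists_isTypeHStar_of_correlation
    (digitBlock ![5758, 5658, 5659, 5237] ![523, 622, 622, 5658])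
    (digitBlock_sq _ _) (by decide +kernel)

theorem exists_isTypeHStar_thirtySeven :
    ∃ B : Fin 4 → Finset (ZMod 2 × ZMod 37), IsTypeHStar B :=
  exists_isTypeHStar_of_correlation
    (digitBlock ![41370444132, 41370444132, 62827160032, 73175705957]
      ![41370444133, 96068509338, 130136874971, 96077360634])
    (digitBlock_sq _ _) (by decide +kernel)

end Sporadic

/-! ### The infinite families -/

section Families

lemma exists_quadratic_extension {q : ℕ} (hq : IsPrimePow q) (hodd : Odd q) :
    ∃ (F K : Type) (_ : Field F) (_ : Field K) (_ : Fintype F) (_ : Fintype K) (_ : Algebra F K),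
      Fintype.card F = q ∧ Fintype.card K = Fintype.card F ^ 2 ∧ ringChar K ≠ 2 := by
  obtain ⟨p, n, hp, hn, rfl⟩ := hq
  have : Fact p.Prime := ⟨hp.nat_prime⟩
  let F := GaloisField p n
  let K := FiniteField.Extension F p 2
  let _ : Fintype F := Fintype.ofFinite F
  let _ : Fintype K := Fintype.ofFinite K
  have hF : Fintype.card F = p ^ n := by
    rw [Fintype.card_eq_nat_card, GaloisField.card p n hn.ne']
  have hK : Fintype.card K = Fintype.card F ^ 2 := by
    rw [Fintype.card_eq_nat_card, Fintype.card_eq_nat_card]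
    exact FiniteField.natCard_extension F p 2
  refine ⟨F, K, inferInstance, inferInstance, inferInstance, inferInstance, inferInstance, hF, hK,
    fun h => ?_⟩
  have h1 := FiniteField.even_card_of_char_two h
  rw [← Nat.even_iff, hK, hF, Nat.even_pow] at h1
  exact (Nat.not_even_iff_odd.mpr hodd) h1.1

/-- There is a difference family of type `H_4^*` in some abelian group of order `2 * v`. -/
def HasDifferenceFamily (v : ℕ) : Prop :=
  ∃ (G : Type) (_ : AddCommGroup G) (_ : Fintype G) (_ : DecidableEq G),
    Fintype.card G = 2 * v ∧ ∃ B : Fin 4 → Finset G, IsTypeHStar B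

lemma IsSeed.hasDifferenceFamily {H : Type} [AddCommGroup H] [Fintype H]
    {w₁ w₂ r₁ r₂ e : H → ℤ} (h : IsSeed w₁ w₂ r₁ r₂ e) :
    HasDifferenceFamily (Fintype.card H) := by
  classical
  exact ⟨ZMod 2 × H, inferInstance, inferInstance, inferInstance,
    by rw [Fintype.card_prod, ZMod.card], h.exists_isTypeHStar⟩

theorem hasDifferenceFamily_sq {q : ℕ} (hq : IsPrimePow q) (h4 : q ≡ 1 [MOD 4]) :
    HasDifferenceFamily (q ^ 2) := by
  classical
  have h4' : q % 4 = 1 := h4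
  obtain ⟨F, K, _, _, _, _, _, hF, hK, h2⟩ :=
    exists_quadratic_extension hq (Nat.odd_iff.mpr (by omega))
  obtain ⟨w₁, w₂, r₁, r₂, e, h⟩ := exists_isSeed_plane hK h2 (by rw [hF, h4'])
  have := h.hasDifferenceFamily
  rwa [Fintype.card_prod, hF, ← sq] at this

/-- There is a pure seed on some abelian group of order `v`. -/
def HasPureSeed (v : ℕ) : Prop :=
  ∃ (H : Type) (_ : AddCommGroup H) (_ : Fintype H) (w₁ w₂ r₁ r₂ : H → ℤ),
    Fintype.card H = v ∧ IsPureSeed w₁ w₂ r₁ r₂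

lemma HasPureSeed.hasDifferenceFamily {v : ℕ} (h : HasPureSeed v) : HasDifferenceFamily v := by
  obtain ⟨H, _, _, w₁, w₂, r₁, r₂, rfl, h⟩ := h
  exact h.isSeed.hasDifferenceFamily

lemma HasPureSeed.mul {v v' : ℕ} (h : HasPureSeed v) (h' : HasPureSeed v') :
    HasPureSeed (v * v') := by
  obtain ⟨H, _, _, w₁, w₂, r₁, r₂, rfl, h⟩ := h
  obtain ⟨H', _, _, w₁', w₂', r₁', r₂', rfl, h'⟩ := h'
  exact ⟨H × H', inferInstance, inferInstance, _, _, _, _, Fintype.card_prod H H', h.prod h'⟩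

lemma hasPureSeed_prime_pow_four {p : ℕ} (hp : p.Prime) (hodd : Odd p) : HasPureSeed (p ^ 4) := by
  obtain ⟨F, K, _, _, _, _, _, hF, hK, h2⟩ := exists_quadratic_extension hp.isPrimePow hodd
  obtain ⟨w₁, w₂, r₁, r₂, h⟩ := exists_isPureSeed_plane hK h2 (by rwa [hF])
  exact ⟨K × K, inferInstance, inferInstance, w₁, w₂, r₁, r₂,
    by rw [Fintype.card_prod, hK, hF]; ring, h⟩

theorem hasPureSeed_pow_four {n : ℕ} (hn : Odd n) : HasPureSeed (n ^ 4) := by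
  induction n using Nat.recOnMul with
  | zero => simp at hn
  | one =>
    exact ⟨Unit, inferInstance, inferInstance, 1, 1, 0, 0, rfl, isPureSeed_trivial⟩
  | prime p hp => exact hasPureSeed_prime_pow_four hp hn
  | mul a b ha hb =>
    rw [mul_pow]
    exact (ha (Nat.odd_mul.mp hn).1).mul (hb (Nat.odd_mul.mp hn).2)

lemma hasPureSeed_nine : HasPureSeed 9 :=
  ⟨ZMod 3 × ZMod 3, inferInstance, inferInstance, _, _, _, _, rfl, isPureSeed_nine⟩

end Families

end HStar

theorem mainTheorem3 :
    ∀ v ∈ Phi1 ∪ Phi2 ∪ Phi3 ∪ Phi4,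
      ∃ (G : Type) (_ : AddCommGroup G) (_ : Fintype G) (_ : DecidableEq G),
        Fintype.card G = 2 * v ∧ ∃ B : Fin 4 → Finset G, IsTypeHStar B := by
  rintro v (((⟨q, hq, h4, rfl⟩ | (⟨n, hn, rfl⟩ | ⟨n, hn, rfl⟩)) | h) | h)
  · exact HStar.hasDifferenceFamily_sq hq h4
  · exact (HStar.hasPureSeed_pow_four (Nat.odd_iff.mpr hn)).hasDifferenceFamily
  · exact (HStar.hasPureSeed_nine.mul
      (HStar.hasPureSeed_pow_four (Nat.odd_iff.mpr hn))).hasDifferenceFamily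
  · obtain rfl : v = 5 := h
    exact ⟨ZMod 2 × ZMod 5, inferInstance, inferInstance, inferInstance, rfl,
      HStar.exists_isTypeHStar_five⟩
  · rcases h with h | h
    · obtain rfl : v = 13 := h
      exact ⟨ZMod 2 × ZMod 13, inferInstance, inferInstance, inferInstance, rfl,
        HStar.exists_isTypeHStar_thirteen⟩
    · obtain rfl : v = 37 := h
      exact ⟨ZMod 2 × ZMod 37, inferInstance, inferInstance, inferInstance, rfl,
        HStar.exists_isTypeHStar_thirtySeven⟩
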